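/- Let $K$ be a field of characteristic $\neq 2$. A graded $\mathbb S_2$-module is a $\mathbb Z$-graded $K$-vector space with an action of $\mathbb S_2$ by degree $0$ maps. A binary operadic quadratic datum is a pair $A=(A_1,R(A))$ of a graded $\mathbb S_2$-module $A_1$ and a graded $\mathbb S_3$-submodule $R(A)$ of the arity $3$ part $\mathcal T(A_1)(3)$ of the free operad on $A_1$; a morphism $A\to B$ is a morphism $f:A_1\to B_1$ of graded $\mathbb S_2$-modules such that $\mathcal T(f)(3)$ maps $R(A)$ into $R(B)$. These form the category $\mathbf{BOQD}$. The space $\mathcal T(A_1)(3)$ is the direct sum of three copies of $A_1\otimes A_1$, consisting of the operations $\tau_1(a,a')=a(a'(x,y),z)$, $\tau_2(a,a')=a(a'(y,z),x)$, $\tau_3(a,a')=a(a'(z,x),y)$. Let $\chi$ be one of the two characters of $\mathbb S_2$: the signature $\mathrm{sgn}$ (which gives the black product of Ginzburg–Kapranov and Vallette) or the trivial character. The black product is $$A\bullet B=\bigl(A_1\otimes B_1\otimes\chi,\ \Psi(R(A)\otimes R(B))\bigr),\qquad \Psi(\tau_i(a,a')\otimes\tau_j(b,b'))=\delta_{ij}(-1)^{|a'||b|}\tau_i(a\otimes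 b,a'\otimes b'),$$ with unit $(\chi,\langle\tau_1(e,e)+\tau_2(e,e)+\tau_3(e,e)\rangle)$, where $e$ generates $\chi$ in degree $0$. The product $\underline{\circledcirc}$ is $$A\,\underline{\circledcirc}\,B=\bigl(A_1\oplus B_1,\ R(A)\oplus\{A_1,B_1\}\oplus R(B)\bigr),$$ with unit $(0,0)$, where $\{A_1,B_1\}$ is the $\mathbb S_3$-submodule of $\mathcal T(A_1\oplus B_1)(3)$ spanned by $\tau_1(a,b)+(-1)^{|a||b|}\tau_1(b,a)$ for homogeneous $a\in A_1$, $b\in B_1$ that are either both $\mathbb S_2$-invariant or both $\mathbb S_2$-antiinvariant. Both products are monoidal structures on $\mathbf{BOQD}$, with the associators and unitors of $\otimes$ and $\oplus$ on the generators. Then for all $A,A',B,B'$ in $\mathbf{BOQD}$ the projection $$(A_1\oplus A_1')\otimes(B_1\oplus B_1')\to(A_1\otimes B_1)\oplus(A_1'\otimes B_1')$$ onto the first and the fourth summand of $(A_1\otimes B_1)\oplus(A_1'\otimes B_1)\oplus(A_1\otimes B_1')\oplus(A_1'\otimes B_1')$ is a morphism in $\mathbf{BOQD}$ $$\varphi_{AA'BB'}:(A\,\underline{\circledcirc}\,A')\bullet(B\,\underline{\circledcirc}\,B')\to(A\bullet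 B)\,\underline{\circledcirc}\,(A'\bullet B').$$ These morphisms make $(\mathbf{BOQD},\bullet,\underline{\circledcirc},\varphi)$ a lax $2$-monoidal category, that is, together with a suitable morphism of units they make $\underline{\circledcirc}:(\mathbf{BOQD},\bullet)^2\to(\mathbf{BOQD},\bullet)$ a lax monoidal functor; and they make $(\mathbf{BOQD},\underline{\circledcirc},\bullet,\varphi)$ a colax $2$-monoidal category, that is, together with a suitable morphism of units they make $\bullet:(\mathbf{BOQD},\underline{\circledcirc})^2\to(\mathbf{BOQD},\underline{\circledcirc})$ a colax monoidal functor. -/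

import Mathlib

open CategoryTheory TensorProduct DirectSum

universe u

/-- A graded `S₂`-module over `K`: a `ℤ`-graded vector space `carrier = ⨁ₙ deg n` with an action
`ρ` of `S₂ = Perm (Fin 2)` by linear maps of degree zero. -/
structure GrS2Mod (K : Type u) [Field K] where
  carrier : Type u
  [addCommGroup : AddCommGroup carrier]
  [module : Module K carrier]
  deg : ℤ → Submodule K carrier
  internal : DirectSum.IsInternal deg
  ρ : Representation K (Equiv.Perm (Fin 2)) carrier
  ρ_deg : ∀ (σ : Equiv.Perm (Fin 2)) (n : ℤ) (x : carrier), x ∈ deg n → ρ σ x ∈ deg n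

attribute [instance] GrS2Mod.addCommGroup GrS2Mod.module

namespace GrS2Mod

variable {K : Type u} [Field K]

instance : CoeSort (GrS2Mod K) (Type u) := ⟨GrS2Mod.carrier⟩

/-- The decomposition of a graded module into its homogeneous components. -/
noncomputable def decomp (A : GrS2Mod K) : A.carrier ≃ₗ[K] ⨁ i, A.deg i :=
  (LinearEquiv.ofBijective (DirectSum.coeLinearMap A.deg) A.internal).symm

theorem decomp_of_mem (A : GrS2Mod K) {i : ℤ} {a : A.carrier} (ha : a ∈ A.deg i) :
    A.decomp a = DirectSum.lof K ℤ (fun i => A.deg i) i ⟨a, ha⟩ := by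
  rw [decomp, LinearEquiv.symm_apply_eq]
  exact (DirectSum.coeLinearMap_lof A.deg i ⟨a, ha⟩).symm

theorem homog_ext {A : GrS2Mod K} {M : Type*} [AddCommGroup M] [Module K M]
    {f g : A.carrier →ₗ[K] M} (h : ∀ i, ∀ a ∈ A.deg i, f a = g a) : f = g := by
  have : f ∘ₗ A.decomp.symm.toLinearMap = g ∘ₗ A.decomp.symm.toLinearMap := by
    apply DirectSum.linearMap_ext
    intro i
    ext a
    have e : A.decomp.symm (DirectSum.lof K ℤ (fun i => A.deg i) i a) = a :=
      DirectSum.coeLinearMap_lof A.deg i a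
    simpa [e] using h i a a.2
  ext a
  simpa using LinearMap.congr_fun this (A.decomp a)

theorem homog_induction {A : GrS2Mod K} {p : A.carrier → Prop} (h0 : p 0)
    (hh : ∀ i, ∀ a ∈ A.deg i, p a) (hadd : ∀ x y, p x → p y → p (x + y)) (x : A.carrier) : p x := by
  have hx : x ∈ iSup A.deg := by rw [A.internal.submodule_iSup_eq_top]; trivial
  exact Submodule.iSup_induction A.deg (motive := p) hx hh h0 hadd

theorem tensor_induction {A B : GrS2Mod K} {p : A.carrier ⊗[K] B.carrier → Prop} (h0 : p 0)
    (hh : ∀ i j, ∀ a ∈ A.deg i, ∀ b ∈ B.deg j, p (a ⊗ₜ b))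
    (hadd : ∀ x y, p x → p y → p (x + y)) (x : A.carrier ⊗[K] B.carrier) : p x := by
  induction x using TensorProduct.induction_on with
  | zero => exact h0
  | add x y hx hy => exact hadd x y hx hy
  | tmul a b =>
    induction a using homog_induction with
    | h0 => simpa using h0
    | hadd x y hx hy => rw [add_tmul]; exact hadd _ _ hx hy
    | hh i a ha =>
      induction b using homog_induction with
      | h0 => simpa using h0
      | hadd x y hx hy => rw [tmul_add]; exact hadd _ _ hx hy
      | hh j b hb => exact hh i j a ha b hb

/-- The sign `(-1)^n`, as an element of `K`. -/
def ksign (K : Type u) [Field K] (n : ℤ) : K := ((n.negOnePow : ℤ) : K)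

theorem ksign_add (m n : ℤ) : ksign K (m + n) = ksign K m * ksign K n := by
  simp [ksign, Int.negOnePow_add]

theorem ksign_zero : ksign K 0 = 1 := by simp [ksign]

theorem isInternal_of_retraction {V : Type u} [AddCommGroup V] [Module K V]
    (𝒱 : ℤ → Submodule K V) (D : V →ₗ[K] ⨁ i, 𝒱 i)
    (h1 : ∀ v, DirectSum.coeLinearMap 𝒱 (D v) = v)
    (h2 : ∀ i, ∀ v ∈ 𝒱 i, ∃ h : v ∈ 𝒱 i, D v = DirectSum.lof K ℤ (fun i => 𝒱 i) i ⟨v, h⟩) :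
    DirectSum.IsInternal 𝒱 := by
  have h3 : D ∘ₗ DirectSum.coeLinearMap 𝒱 = LinearMap.id := by
    apply DirectSum.linearMap_ext
    intro i
    ext1 ⟨v, hv⟩
    obtain ⟨_, h⟩ := h2 i v hv
    simp [h]
  constructor
  · intro x y hxy
    have := congrArg D (show DirectSum.coeLinearMap 𝒱 x = DirectSum.coeLinearMap 𝒱 y from hxy)
    simpa using (LinearMap.congr_fun h3 x).symm.trans (this.trans (LinearMap.congr_fun h3 y))
  · intro v
    exact ⟨D v, h1 v⟩

/-- The grading `(A ⊗ B)ₙ = ⨁_{i + j = n} Aᵢ ⊗ Bⱼ` of the tensor product. -/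
def tensorDeg (A B : GrS2Mod K) (n : ℤ) : Submodule K (A.carrier ⊗[K] B.carrier) :=
  ⨆ p : {p : ℤ × ℤ // p.1 + p.2 = n},
    Submodule.map₂ (TensorProduct.mk K A.carrier B.carrier) (A.deg p.1.1) (B.deg p.1.2)

theorem tmul_mem (A B : GrS2Mod K) {i j n : ℤ} (h : i + j = n) {a : A.carrier} {b : B.carrier}
    (ha : a ∈ A.deg i) (hb : b ∈ B.deg j) : a ⊗ₜ[K] b ∈ tensorDeg A B n :=
  Submodule.mem_iSup_of_mem (⟨(i, j), h⟩ : {p : ℤ × ℤ // p.1 + p.2 = n})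
    (Submodule.apply_mem_map₂ (TensorProduct.mk K A.carrier B.carrier) ha hb)

theorem tensorDeg_le (A B : GrS2Mod K) (n : ℤ) {P : Submodule K (A.carrier ⊗[K] B.carrier)}
    (h : ∀ i j, i + j = n → ∀ a ∈ A.deg i, ∀ b ∈ B.deg j, a ⊗ₜ b ∈ P) : tensorDeg A B n ≤ P := by
  refine iSup_le fun p => Submodule.map₂_le.2 fun a ha b hb => h _ _ p.2 a ha b hb

/-- The map decomposing an element of `A ⊗ B` into homogeneous components. -/
noncomputable def tensorDecomp (A B : GrS2Mod K) :
    A.carrier ⊗[K] B.carrier →ₗ[K] ⨁ n, tensorDeg A B n :=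
  TensorProduct.lift <|
    (DirectSum.toModule K ℤ (B.carrier →ₗ[K] ⨁ n, tensorDeg A B n) fun i =>
      LinearMap.flip <| (DirectSum.toModule K ℤ (A.deg i →ₗ[K] ⨁ n, tensorDeg A B n) fun j =>
        LinearMap.mk₂ K (fun (b : B.deg j) (a : A.deg i) =>
          DirectSum.lof K ℤ (fun n => tensorDeg A B n) (i + j)
            ⟨a.1 ⊗ₜ b.1, tmul_mem A B rfl a.2 b.2⟩)
          (fun b b' a => by rw [← map_add]; congr 1; ext; simp [tmul_add])
          (fun c b a => by rw [← map_smul]; congr 1; ext; simp)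
          (fun b a a' => by rw [← map_add]; congr 1; ext; simp [add_tmul])
          (fun c b a => by rw [← map_smul]; congr 1)) ∘ₗ
          B.decomp.toLinearMap) ∘ₗ A.decomp.toLinearMap

theorem tensorDecomp_tmul (A B : GrS2Mod K) {i j n : ℤ} (h : i + j = n)
    {a : A.carrier} {b : B.carrier} (ha : a ∈ A.deg i) (hb : b ∈ B.deg j) :
    tensorDecomp A B (a ⊗ₜ b) = DirectSum.lof K ℤ (fun n => tensorDeg A B n) n
      ⟨a ⊗ₜ b, tmul_mem A B h ha hb⟩ := by
  subst h
  simp [tensorDecomp, decomp_of_mem A ha, decomp_of_mem B hb]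

theorem tensor_internal (A B : GrS2Mod K) : DirectSum.IsInternal (tensorDeg A B) := by
  refine isInternal_of_retraction _ (tensorDecomp A B) ?_ ?_
  · intro v
    induction v using tensor_induction with
    | h0 => simp
    | hadd x y hx hy => simp [hx, hy]
    | hh i j a ha b hb => simp [tensorDecomp_tmul A B rfl ha hb]
  · intro n v hv
    refine ⟨hv, ?_⟩
    let P : Submodule K (A.carrier ⊗[K] B.carrier) :=
      { carrier := {v | ∃ h : v ∈ tensorDeg A B n,
          tensorDecomp A B v = DirectSum.lof K ℤ (fun n => tensorDeg A B n) n ⟨v, h⟩}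
        zero_mem' := ⟨zero_mem _, by
          rw [map_zero, ← map_zero (DirectSum.lof K ℤ (fun n => tensorDeg A B n) n)]; rfl⟩
        add_mem' := by
          rintro x y ⟨hx, hx'⟩ ⟨hy, hy'⟩
          exact ⟨add_mem hx hy, by rw [map_add, hx', hy', ← map_add]; rfl⟩
        smul_mem' := by
          rintro c x ⟨hx, hx'⟩
          exact ⟨Submodule.smul_mem _ c hx, by rw [map_smul, hx', ← map_smul]; rfl⟩ }
    have : tensorDeg A B n ≤ P := tensorDeg_le A B n fun i j h a ha b hb =>
      ⟨tmul_mem A B h ha hb, tensorDecomp_tmul A B h ha hb⟩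
    exact (this hv).2

theorem map_mem_tensorDeg {A B A' B' : GrS2Mod K} {f : A.carrier →ₗ[K] A'.carrier}
    {g : B.carrier →ₗ[K] B'.carrier} (hf : ∀ n, ∀ x ∈ A.deg n, f x ∈ A'.deg n)
    (hg : ∀ n, ∀ x ∈ B.deg n, g x ∈ B'.deg n) {n : ℤ} {x : A.carrier ⊗[K] B.carrier}
    (hx : x ∈ tensorDeg A B n) : TensorProduct.map f g x ∈ tensorDeg A' B' n := by
  have : tensorDeg A B n ≤ (tensorDeg A' B' n).comap (TensorProduct.map f g) :=
    tensorDeg_le A B n fun i j h a ha b hb => tmul_mem A' B' h (hf _ _ ha) (hg _ _ hb)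
  exact this hx

/-- A character `χ` of `S₂` (there are two, the trivial one and the sign), with values in `K`. -/
def chi (K : Type u) [Field K] (χ : Equiv.Perm (Fin 2) →* ℤˣ) : Equiv.Perm (Fin 2) →* K :=
  ((Int.castRingHom K : ℤ →* K).comp (Units.coeHom ℤ)).comp χ



/-- The action `σ (a ⊗ b) = χ(σ) (σ a ⊗ σ b)` of `S₂` on `A ⊗ B ⊗ χ`. -/
noncomputable def tensorRep (χ : Equiv.Perm (Fin 2) →* ℤˣ) (A B : GrS2Mod K) :
    Representation K (Equiv.Perm (Fin 2)) (A.carrier ⊗[K] B.carrier) where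
  toFun σ := chi K χ σ • TensorProduct.map (A.ρ σ) (B.ρ σ)
  map_one' := by simp
  map_mul' σ τ := by
    rw [map_mul, map_mul, map_mul, smul_mul_smul_comm, ← TensorProduct.map_mul]

theorem tensorRep_tmul (χ : Equiv.Perm (Fin 2) →* ℤˣ) (A B : GrS2Mod K) (σ : Equiv.Perm (Fin 2))
    (a : A.carrier) (b : B.carrier) :
    tensorRep χ A B σ (a ⊗ₜ b) = chi K χ σ • (A.ρ σ a ⊗ₜ B.ρ σ b) := rfl

/-- The graded `S₂`-module `A ⊗ B ⊗ χ`. For `χ = 1` it is the Hadamard tensor product `A ⊗ B`,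
for `χ = sign` it is `A ⊗ B ⊗ sgn`. -/
noncomputable abbrev tensor (χ : Equiv.Perm (Fin 2) →* ℤˣ) (A B : GrS2Mod K) : GrS2Mod K where
  carrier := A.carrier ⊗[K] B.carrier
  deg := tensorDeg A B
  internal := tensor_internal A B
  ρ := tensorRep χ A B
  ρ_deg := fun σ _ _ hx =>
    Submodule.smul_mem _ _ (map_mem_tensorDeg (A.ρ_deg σ) (B.ρ_deg σ) hx)

/-- `K`, concentrated in degree `0`. -/
def unitDeg (K : Type u) [Field K] (n : ℤ) : Submodule K K := if n = 0 then ⊤ else ⊥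

theorem unit_internal (K : Type u) [Field K] : DirectSum.IsInternal (unitDeg K) := by
  refine isInternal_of_retraction (unitDeg K)
    (DirectSum.lof K ℤ (fun n : ℤ => unitDeg K n) 0 ∘ₗ
      LinearMap.codRestrict (unitDeg K 0) LinearMap.id (by simp [unitDeg])) ?_ ?_
  · intro v; simp
  · intro i v hv
    refine ⟨hv, ?_⟩
    by_cases h : i = 0
    · subst h; rfl
    · have : v = 0 := by simpa [h, unitDeg] using hv
      subst this
      rw [map_zero]
      exact (map_zero (DirectSum.lof K ℤ (fun n : ℤ => unitDeg K n) i)).symm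

/-- The one-dimensional representation of `S₂` with character `χ`. -/
noncomputable def unitRep (K : Type u) [Field K] (χ : Equiv.Perm (Fin 2) →* ℤˣ) :
    Representation K (Equiv.Perm (Fin 2)) K where
  toFun σ := chi K χ σ • LinearMap.id
  map_one' := by ext; simp
  map_mul' σ τ := by
    rw [map_mul, smul_mul_smul_comm]; rfl

/-- The one-dimensional graded `S₂`-module with character `χ`, in degree `0`. -/
noncomputable abbrev unit (K : Type u) [Field K] (χ : Equiv.Perm (Fin 2) →* ℤˣ) : GrS2Mod K where
  carrier := K
  deg := unitDeg K
  internal := unit_internal K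
  ρ := unitRep K χ
  ρ_deg := fun _ _ _ hx => Submodule.smul_mem _ _ hx

/-- The grading of the direct sum. -/
def sumDeg (A B : GrS2Mod K) (n : ℤ) : Submodule K (A.carrier × B.carrier) :=
  (A.deg n).prod (B.deg n)

/-- The map decomposing an element of `A ⊕ B` into homogeneous components. -/
noncomputable def sumDecomp (A B : GrS2Mod K) : A.carrier × B.carrier →ₗ[K] ⨁ n, sumDeg A B n :=
  LinearMap.coprod
    (DirectSum.toModule K ℤ _ (fun i => DirectSum.lof K ℤ (fun n => sumDeg A B n) i ∘ₗ
      LinearMap.codRestrict (sumDeg A B i) (LinearMap.inl K _ _ ∘ₗ (A.deg i).subtype)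
        (fun a => ⟨a.2, zero_mem _⟩)) ∘ₗ A.decomp.toLinearMap)
    (DirectSum.toModule K ℤ _ (fun i => DirectSum.lof K ℤ (fun n => sumDeg A B n) i ∘ₗ
      LinearMap.codRestrict (sumDeg A B i) (LinearMap.inr K _ _ ∘ₗ (B.deg i).subtype)
        (fun a => ⟨zero_mem _, a.2⟩)) ∘ₗ B.decomp.toLinearMap)

theorem sumDecomp_mk (A B : GrS2Mod K) {i : ℤ} {a : A.carrier} {b : B.carrier}
    (ha : a ∈ A.deg i) (hb : b ∈ B.deg i) :
    sumDecomp A B (a, b) = DirectSum.lof K ℤ (fun n => sumDeg A B n) i ⟨(a, b), ha, hb⟩ := by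
  rw [sumDecomp, LinearMap.coprod_apply, LinearMap.comp_apply, LinearMap.comp_apply]
  simp only [LinearEquiv.coe_coe, decomp_of_mem A ha, decomp_of_mem B hb,
    DirectSum.toModule_lof, LinearMap.comp_apply]
  rw [← map_add]
  congr 1
  ext
  · exact add_zero a
  · exact zero_add b

theorem sum_internal (A B : GrS2Mod K) : DirectSum.IsInternal (sumDeg A B) := by
  refine isInternal_of_retraction (sumDeg A B) (sumDecomp A B) ?_ ?_
  · rintro ⟨a, b⟩
    have h : ∀ a : A.carrier,
        DirectSum.coeLinearMap (sumDeg A B) (sumDecomp A B (a, 0)) = (a, 0) := by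
      intro a
      induction a using homog_induction with
      | h0 => rw [← Prod.zero_eq_mk, map_zero, map_zero]
      | hadd x y hx hy =>
        rw [show ((x + y, 0) : A.carrier × B.carrier) = (x, 0) + (y, 0) by simp, map_add, map_add,
          hx, hy]
      | hh i a ha => rw [sumDecomp_mk A B ha (zero_mem _), DirectSum.coeLinearMap_lof]
    have h' : ∀ b : B.carrier,
        DirectSum.coeLinearMap (sumDeg A B) (sumDecomp A B (0, b)) = (0, b) := by
      intro b
      induction b using homog_induction with
      | h0 => rw [← Prod.zero_eq_mk, map_zero, map_zero]
      | hadd x y hx hy =>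
        rw [show ((0, x + y) : A.carrier × B.carrier) = (0, x) + (0, y) by simp, map_add, map_add,
          hx, hy]
      | hh i b hb => rw [sumDecomp_mk A B (zero_mem _) hb, DirectSum.coeLinearMap_lof]
    rw [show ((a, b) : A.carrier × B.carrier) = (a, 0) + (0, b) by simp, map_add, map_add, h, h']
  · rintro i ⟨a, b⟩ hv
    exact ⟨hv, sumDecomp_mk A B hv.1 hv.2⟩

/-- The action of `S₂` on the direct sum. -/
noncomputable def sumRep (A B : GrS2Mod K) :
    Representation K (Equiv.Perm (Fin 2)) (A.carrier × B.carrier) where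
  toFun σ := LinearMap.prodMap (A.ρ σ) (B.ρ σ)
  map_one' := by rw [map_one, map_one]; rfl
  map_mul' σ τ := by rw [map_mul, map_mul]; rfl

/-- The direct sum `A ⊕ B` of graded `S₂`-modules. -/
noncomputable abbrev directSum (A B : GrS2Mod K) : GrS2Mod K where
  carrier := A.carrier × B.carrier
  deg := sumDeg A B
  internal := sum_internal A B
  ρ := sumRep A B
  ρ_deg := fun σ n _ hx => ⟨A.ρ_deg σ n _ hx.1, B.ρ_deg σ n _ hx.2⟩

/-- The grading of the zero module. -/
def zeroDeg (K : Type u) [Field K] (_ : ℤ) : Submodule K PUnit.{u + 1} := ⊥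

theorem zero_internal (K : Type u) [Field K] : DirectSum.IsInternal (zeroDeg K) := by
  refine isInternal_of_retraction (zeroDeg K) 0 (fun v => Subsingleton.elim _ _) ?_
  intro i v hv
  refine ⟨hv, ?_⟩
  have : (⟨v, hv⟩ : zeroDeg K i) = 0 := Subsingleton.elim _ _
  rw [this]
  exact (map_zero (DirectSum.lof K ℤ (fun n : ℤ => zeroDeg K n) i)).symm

/-- The zero graded `S₂`-module. -/
noncomputable abbrev zero (K : Type u) [Field K] : GrS2Mod K where
  carrier := PUnit
  deg := zeroDeg K
  internal := zero_internal K
  ρ := 1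
  ρ_deg := fun _ _ _ h => h

/-- The operator `a ↦ (-1)^(i|a|) a`. -/
noncomputable def signPow (A : GrS2Mod K) (i : ℤ) : A.carrier →ₗ[K] A.carrier :=
  DirectSum.toModule K ℤ A.carrier (fun j => ksign K (i * j) • (A.deg j).subtype) ∘ₗ
    A.decomp.toLinearMap

theorem signPow_of_mem (A : GrS2Mod K) (i : ℤ) {j : ℤ} {a : A.carrier} (ha : a ∈ A.deg j) :
    A.signPow i a = ksign K (i * j) • a := by
  simp [signPow, decomp_of_mem A ha]

/-- The operator `a ⊗ b ↦ (-1)^(|a||b|) a ⊗ b`, see `koszul_tmul`. -/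
noncomputable def koszul (A B : GrS2Mod K) :
    A.carrier ⊗[K] B.carrier →ₗ[K] A.carrier ⊗[K] B.carrier :=
  TensorProduct.lift
    (DirectSum.toModule K ℤ (B.carrier →ₗ[K] A.carrier ⊗[K] B.carrier) (fun i =>
      (TensorProduct.mk K A.carrier B.carrier).compl₂ (B.signPow i) ∘ₗ (A.deg i).subtype) ∘ₗ
      A.decomp.toLinearMap)

theorem koszul_tmul (A B : GrS2Mod K) {i j : ℤ} {a : A.carrier} {b : B.carrier}
    (ha : a ∈ A.deg i) (hb : b ∈ B.deg j) :
    koszul A B (a ⊗ₜ b) = ksign K (i * j) • (a ⊗ₜ[K] b) := by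
  simp [koszul, decomp_of_mem A ha, signPow_of_mem B i hb]

/-- The exchange of the two middle factors with its Koszul sign,
`(a ⊗ a') ⊗ (b ⊗ b') ↦ (-1)^(|a'||b|) (a ⊗ b) ⊗ (a' ⊗ b')`, see `middleSwap_tmul`. -/
noncomputable def middleSwap (A A' B B' : GrS2Mod K) :
    (A.carrier ⊗[K] A'.carrier) ⊗[K] (B.carrier ⊗[K] B'.carrier) →ₗ[K]
      (A.carrier ⊗[K] B.carrier) ⊗[K] (A'.carrier ⊗[K] B'.carrier) :=
  let e : (A.carrier ⊗[K] A'.carrier) ⊗[K] (B.carrier ⊗[K] B'.carrier) ≃ₗ[K]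
      A.carrier ⊗[K] ((A'.carrier ⊗[K] B.carrier) ⊗[K] B'.carrier) :=
    TensorProduct.assoc K A.carrier A'.carrier (B.carrier ⊗[K] B'.carrier) ≪≫ₗ
      TensorProduct.congr (LinearEquiv.refl K A.carrier)
        (TensorProduct.assoc K A'.carrier B.carrier B'.carrier).symm
  (TensorProduct.tensorTensorTensorComm K A.carrier A'.carrier B.carrier B'.carrier).toLinearMap ∘ₗ
    e.symm.toLinearMap ∘ₗ ((koszul A' B).rTensor B'.carrier).lTensor A.carrier ∘ₗ e.toLinearMap

theorem middleSwap_tmul (A A' B B' : GrS2Mod K) {i j : ℤ} (a : A.carrier) {a' : A'.carrier}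
    {b : B.carrier} (b' : B'.carrier) (ha : a' ∈ A'.deg i) (hb : b ∈ B.deg j) :
    middleSwap A A' B B' ((a ⊗ₜ a') ⊗ₜ (b ⊗ₜ b')) =
      ksign K (i * j) • ((a ⊗ₜ[K] b) ⊗ₜ[K] (a' ⊗ₜ[K] b')) := by
  simp [middleSwap, koszul_tmul A' B ha hb, ← smul_tmul']

theorem middleSwap_map {A A' B B' C C' D D' : GrS2Mod K} (f : A.carrier →ₗ[K] C.carrier)
    (f' : A'.carrier →ₗ[K] C'.carrier) (g : B.carrier →ₗ[K] D.carrier)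
    (g' : B'.carrier →ₗ[K] D'.carrier) (hf' : ∀ n, ∀ x ∈ A'.deg n, f' x ∈ C'.deg n)
    (hg : ∀ n, ∀ x ∈ B.deg n, g x ∈ D.deg n) (s : A.carrier ⊗[K] A'.carrier)
    (t : B.carrier ⊗[K] B'.carrier) :
    middleSwap C C' D D' (TensorProduct.map f f' s ⊗ₜ TensorProduct.map g g' t) =
      TensorProduct.map (TensorProduct.map f g) (TensorProduct.map f' g')
        (middleSwap A A' B B' (s ⊗ₜ t)) := by
  induction s using tensor_induction with
  | h0 => simp
  | hadd x y hx hy => simp only [map_add, add_tmul, hx, hy]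
  | hh i j a ha a' ha' =>
    induction t using tensor_induction with
    | h0 => simp
    | hadd x y hx hy => simp only [map_add, tmul_add, hx, hy]
    | hh k l b hb b' hb' =>
      simp only [TensorProduct.map_tmul]
      rw [middleSwap_tmul A A' B B' a b' ha' hb, middleSwap_tmul C C' D D' _ _ (hf' _ _ ha')
        (hg _ _ hb)]
      simp

theorem middleSwap_mem {A A' B B' : GrS2Mod K} (χ : Equiv.Perm (Fin 2) →* ℤˣ) {m n : ℤ}
    {s : A.carrier ⊗[K] A'.carrier} {t : B.carrier ⊗[K] B'.carrier}
    (hs : s ∈ tensorDeg A A' m) (ht : t ∈ tensorDeg B B' n) :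
    middleSwap A A' B B' (s ⊗ₜ t) ∈ tensorDeg (tensor χ A B) (tensor χ A' B') (m + n) := by
  have h1 : ∀ i j k l, i + j = m → k + l = n → ∀ a ∈ A.deg i, ∀ a' ∈ A'.deg j, ∀ b ∈ B.deg k,
      ∀ b' ∈ B'.deg l, middleSwap A A' B B' ((a ⊗ₜ a') ⊗ₜ (b ⊗ₜ b')) ∈
        tensorDeg (tensor χ A B) (tensor χ A' B') (m + n) := by
    intro i j k l hij hkl a ha a' ha' b hb b' hb'
    rw [middleSwap_tmul A A' B B' a b' ha' hb]
    refine Submodule.smul_mem _ _ ?_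
    exact tmul_mem (tensor χ A B) (tensor χ A' B') (i := i + k) (j := j + l) (by omega)
      (tmul_mem A B rfl ha hb) (tmul_mem A' B' rfl ha' hb')
  have h2 : tensorDeg A A' m ≤ (tensorDeg (tensor χ A B) (tensor χ A' B') (m + n)).comap
      (middleSwap A A' B B' ∘ₗ (TensorProduct.mk K _ _).flip t) := by
    refine tensorDeg_le A A' m fun i j hij a ha a' ha' => ?_
    have h3 : tensorDeg B B' n ≤ (tensorDeg (tensor χ A B) (tensor χ A' B') (m + n)).comap
        (middleSwap A A' B B' ∘ₗ TensorProduct.mk K _ _ (a ⊗ₜ a')) :=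
      tensorDeg_le B B' n fun k l hkl b hb b' hb' => h1 i j k l hij hkl a ha a' ha' b hb b' hb'
    exact h3 ht
  exact h2 hs

theorem middleSwap_assoc (χ : Equiv.Perm (Fin 2) →* ℤˣ) (A B C : GrS2Mod K)
    (r : A.carrier ⊗[K] A.carrier) (s : B.carrier ⊗[K] B.carrier) (t : C.carrier ⊗[K] C.carrier) :
    TensorProduct.map (TensorProduct.assoc K A.carrier B.carrier C.carrier).toLinearMap
      (TensorProduct.assoc K A.carrier B.carrier C.carrier).toLinearMap
      (middleSwap (tensor χ A B) (tensor χ A B) C C (middleSwap A A B B (r ⊗ₜ s) ⊗ₜ t)) =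
    middleSwap A A (tensor χ B C) (tensor χ B C) (r ⊗ₜ middleSwap B B C C (s ⊗ₜ t)) := by
  induction r using tensor_induction with
  | h0 => simp
  | hadd x y hx hy => simp only [map_add, add_tmul, hx, hy]
  | hh i i' a ha a' ha' =>
    induction s using tensor_induction with
    | h0 => simp
    | hadd x y hx hy => simp only [map_add, tmul_add, add_tmul, hx, hy]
    | hh j j' b hb b' hb' =>
      induction t using tensor_induction with
      | h0 => simp
      | hadd x y hx hy => simp only [map_add, tmul_add, hx, hy]
      | hh k k' c hc c' hc' =>
        rw [middleSwap_tmul A A B B a b' ha' hb, middleSwap_tmul B B C C b c' hb' hc]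
        rw [← smul_tmul', tmul_smul, map_smul, map_smul, map_smul,
          middleSwap_tmul (tensor χ A B) (tensor χ A B) C C (a ⊗ₜ b) c'
            (tmul_mem A B rfl ha' hb') hc,
          middleSwap_tmul A A (tensor χ B C) (tensor χ B C) a (b' ⊗ₜ c') ha'
            (tmul_mem B C rfl hb hc)]
        rw [map_smul, smul_smul, smul_smul, ← ksign_add, ← ksign_add, TensorProduct.map_tmul,
          LinearEquiv.coe_coe, TensorProduct.assoc_tmul, TensorProduct.assoc_tmul]
        congr 2
        ring


/-- The homomorphism `S₃ → S₂` that sends the odd permutations to the transposition. -/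
def perm3to2 : Equiv.Perm (Fin 3) →* Equiv.Perm (Fin 2) where
  toFun σ := if Equiv.Perm.sign σ = 1 then 1 else Equiv.swap 0 1
  map_one' := by simp
  map_mul' := by decide

/-- The arity three part `𝒯(A)(3)` of the free operad on the graded `S₂`-module `A` (put in arity
two). It is the sum of three copies of `A ⊗ A`, one for each binary tree with leaves `x₀, x₁, x₂`;
the copy with index `o` contains the operations `a(a'(x_{o+1}, x_{o+2}), x_o)`, indices mod `3`. -/
abbrev T3 (A : GrS2Mod K) : Type u := Fin 3 → A.carrier ⊗[K] A.carrier

/-- The operation `tau o a a' = a(a'(x_{o+1}, x_{o+2}), x_o)`. With `(x, y, z) = (x₀, x₁, x₂)`,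
`tau 2 a a' = a(a'(x, y), z)`, `tau 0 a a' = a(a'(y, z), x)` and `tau 1 a a' = a(a'(z, x), y)`. -/
noncomputable def tau {A : GrS2Mod K} (o : Fin 3) (a a' : A.carrier) : A.T3 :=
  Pi.single o (a ⊗ₜ[K] a')

/-- The action of `S₃` on `𝒯(A)(3)` by permutation of the variables, `x_k ↦ x_{σ k}`: the operation
`a(a'(x_{o+1}, x_{o+2}), x_o)` goes to `a(a'(x_{σ(o+1)}, x_{σ(o+2)}), x_{σ o})`, which is
`tau (σ o) a a'` for even `σ` and `tau (σ o) a ((0 1) a')` for odd `σ`, see `act_tau`. -/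
noncomputable def act (A : GrS2Mod K) : Representation K (Equiv.Perm (Fin 3)) A.T3 where
  toFun σ := LinearMap.pi fun o =>
    (A.ρ (perm3to2 σ)).lTensor A.carrier ∘ₗ LinearMap.proj (σ⁻¹ o)
  map_one' := by
    refine LinearMap.ext fun t => funext fun o => ?_
    simp [Module.End.one_eq_id]
  map_mul' σ τ := by
    refine LinearMap.ext fun t => funext fun o => ?_
    simp [Module.End.mul_eq_comp, LinearMap.lTensor_comp]

theorem act_apply (A : GrS2Mod K) (σ : Equiv.Perm (Fin 3)) (t : A.T3) (o : Fin 3) :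
    A.act σ t o = TensorProduct.map LinearMap.id (A.ρ (perm3to2 σ)) (t (σ⁻¹ o)) := rfl

theorem act_tau (A : GrS2Mod K) (σ : Equiv.Perm (Fin 3)) (o : Fin 3) (a a' : A.carrier) :
    A.act σ (tau o a a') = tau (σ o) a (A.ρ (perm3to2 σ) a') := by
  funext p
  rw [act_apply, tau, tau]
  by_cases h : p = σ o
  · subst h; simp
  · have h' : σ⁻¹ p ≠ o := fun e => h (by rw [← e]; simp)
    rw [Pi.single_eq_of_ne h, Pi.single_eq_of_ne h', map_zero]

/-- `𝒯(A)(3)` is the `S₃`-module freely generated by `A ⊗ A`, embedded as the operations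
`a(a'(x, y), z)`, subject to the compatibility with the transposition of `x` and `y`, that is, the
module induced from `S₂` to `S₃`. -/
theorem T3_induced (A : GrS2Mod K) {W : Type*} [AddCommGroup W] [Module K W]
    (π : Representation K (Equiv.Perm (Fin 3)) W) (g : A.carrier ⊗[K] A.carrier →ₗ[K] W)
    (hg : ∀ a a', g (a ⊗ₜ A.ρ (Equiv.swap 0 1) a') = π (Equiv.swap 0 1) (g (a ⊗ₜ a'))) :
    ∃! G : A.T3 →ₗ[K] W, (∀ σ t, G (A.act σ t) = π σ (G t)) ∧
      ∀ a a', G (tau 2 a a') = g (a ⊗ₜ a') := by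
  let c : Fin 3 → Equiv.Perm (Fin 3) := fun o => finRotate 3 ^ (o.1 + 1)
  have hc : ∀ o, c o 2 = o := by decide
  have hs : ∀ o, Equiv.Perm.sign (c o) = 1 := by decide
  have hcσ : ∀ (σ : Equiv.Perm (Fin 3)) o, c (σ o) *
      (if Equiv.Perm.sign σ = 1 then 1 else Equiv.swap 0 1) = σ * c o := by decide
  have hg' : ∀ (σ : Equiv.Perm (Fin 3)) x, g (TensorProduct.map LinearMap.id (A.ρ (perm3to2 σ)) x) =
      π (if Equiv.Perm.sign σ = 1 then 1 else Equiv.swap 0 1) (g x) := by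
    intro σ x
    induction x using TensorProduct.induction_on with
    | zero => simp
    | add x y hx hy => simp only [map_add, hx, hy]
    | tmul a b =>
      rw [TensorProduct.map_tmul]
      change g (a ⊗ₜ A.ρ (if Equiv.Perm.sign σ = 1 then 1 else Equiv.swap 0 1) b) = _
      split_ifs
      · simp
      · exact hg a b
  refine ⟨∑ o, π (c o) ∘ₗ g ∘ₗ LinearMap.proj o, ⟨?_, ?_⟩, ?_⟩
  · intro σ t
    simp only [LinearMap.sum_apply, LinearMap.comp_apply, LinearMap.proj_apply, map_sum]
    rw [← Equiv.sum_comp σ]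
    refine Finset.sum_congr rfl fun o _ => ?_
    rw [act_apply, hg', show σ⁻¹ (σ o) = o by simp, ← Module.End.mul_apply, ← map_mul, hcσ,
      map_mul]
    rfl
  · intro a a'
    simp only [LinearMap.sum_apply, LinearMap.comp_apply, LinearMap.proj_apply, tau]
    rw [Finset.sum_eq_single 2]
    · rw [Pi.single_eq_same, show c 2 = 1 by decide]; simp
    · intro b _ hb
      simp [Pi.single_eq_of_ne hb]
    · simp
  · rintro G ⟨hG, hG'⟩
    refine LinearMap.pi_ext' fun o => TensorProduct.ext' fun a a' => ?_
    have e : ∀ F : A.T3 →ₗ[K] W, (∀ σ t, F (A.act σ t) = π σ (F t)) →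
        F (tau o a a') = π (c o) (F (tau 2 a a')) := by
      intro F hF
      rw [← hF, act_tau, hc]
      simp [perm3to2, hs]
    have e' := (e G hG).trans (congrArg _ (hG' a a'))
    simp only [LinearMap.sum_apply, LinearMap.comp_apply, LinearMap.proj_apply, LinearMap.single_apply]
    rw [Finset.sum_eq_single o]
    · rw [Pi.single_eq_same]; exact e'
    · intro b _ hb
      simp [Pi.single_eq_of_ne hb]
    · simp

/-- The homogeneous elements of degree `n` of `𝒯(A)(3)`. -/
def T3deg (A : GrS2Mod K) (n : ℤ) : Submodule K A.T3 :=
  Submodule.pi Set.univ fun _ => tensorDeg A A n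

/-- The map `𝒯(f)(3) : 𝒯(A)(3) → 𝒯(B)(3)` induced by `f : A → B`. -/
noncomputable def T3map {A B : GrS2Mod K} (f : A.carrier →ₗ[K] B.carrier) : A.T3 →ₗ[K] B.T3 :=
  LinearMap.pi fun o => TensorProduct.map f f ∘ₗ LinearMap.proj o

theorem T3map_apply {A B : GrS2Mod K} (f : A.carrier →ₗ[K] B.carrier) (t : A.T3) (o : Fin 3) :
    T3map f t o = TensorProduct.map f f (t o) := rfl

theorem T3map_id (A : GrS2Mod K) : T3map (A := A) (B := A) LinearMap.id = LinearMap.id := by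
  refine LinearMap.ext fun t => funext fun o => ?_; simp [T3map_apply]

theorem T3map_comp {A B C : GrS2Mod K} (g : B.carrier →ₗ[K] C.carrier)
    (f : A.carrier →ₗ[K] B.carrier) : T3map (g ∘ₗ f) = T3map (B := C) g ∘ₗ T3map (A := A) f := by
  refine LinearMap.ext fun t => funext fun o => ?_
  simp only [T3map_apply, LinearMap.comp_apply, TensorProduct.map_comp]

theorem T3map_tau {A B : GrS2Mod K} (f : A.carrier →ₗ[K] B.carrier) (o : Fin 3)
    (a a' : A.carrier) : T3map f (tau o a a') = tau o (f a) (f a') := by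
  funext p
  rw [T3map_apply, tau, tau]
  by_cases h : p = o
  · subst h; simp
  · simp [Pi.single_eq_of_ne h]

/-- `f` is a morphism of graded `S₂`-modules: linear, of degree zero and equivariant. -/
structure IsHom {A B : GrS2Mod K} (f : A.carrier →ₗ[K] B.carrier) : Prop where
  deg : ∀ (n : ℤ) (x : A.carrier), x ∈ A.deg n → f x ∈ B.deg n
  equivariant : ∀ (σ : Equiv.Perm (Fin 2)) (x : A.carrier), f (A.ρ σ x) = B.ρ σ (f x)

theorem IsHom.id (A : GrS2Mod K) : IsHom (A := A) (B := A) LinearMap.id :=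
  ⟨fun _ _ h => h, fun _ _ => rfl⟩

theorem IsHom.comp {A B C : GrS2Mod K} {g : B.carrier →ₗ[K] C.carrier}
    {f : A.carrier →ₗ[K] B.carrier} (hg : IsHom g) (hf : IsHom f) : IsHom (g ∘ₗ f) :=
  ⟨fun n x h => hg.deg n _ (hf.deg n x h), fun σ x => by
    rw [LinearMap.comp_apply, hf.equivariant, hg.equivariant]; rfl⟩

theorem T3map_act {A B : GrS2Mod K} {f : A.carrier →ₗ[K] B.carrier} (hf : IsHom f)
    (σ : Equiv.Perm (Fin 3)) (t : A.T3) : T3map f (A.act σ t) = B.act σ (T3map f t) := by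
  funext o
  rw [T3map_apply, act_apply, act_apply, T3map_apply, ← LinearMap.comp_apply,
    ← LinearMap.comp_apply, ← TensorProduct.map_comp, ← TensorProduct.map_comp]
  congr 2
  ext x
  exact hf.equivariant _ _

theorem T3map_deg {A B : GrS2Mod K} {f : A.carrier →ₗ[K] B.carrier} (hf : IsHom f) {n : ℤ}
    {t : A.T3} (ht : t ∈ A.T3deg n) : T3map f t ∈ B.T3deg n :=
  fun o ho => map_mem_tensorDeg hf.deg hf.deg (ht o ho)

theorem act_deg (A : GrS2Mod K) (σ : Equiv.Perm (Fin 3)) {n : ℤ} {t : A.T3}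
    (ht : t ∈ A.T3deg n) : A.act σ t ∈ A.T3deg n :=
  fun o _ => map_mem_tensorDeg (fun _ _ h => h) (A.ρ_deg _) (ht (σ⁻¹ o) trivial)

theorem tau_deg (A : GrS2Mod K) {i j n : ℤ} (h : i + j = n) (o : Fin 3) {a a' : A.carrier}
    (ha : a ∈ A.deg i) (ha' : a' ∈ A.deg j) : tau o a a' ∈ A.T3deg n := by
  intro p _
  rw [tau]
  by_cases hp : p = o
  · subst hp; simpa using tmul_mem A A h ha ha'
  · simp [Pi.single_eq_of_ne hp]

/-- The map `Ψ : 𝒯(A)(3) ⊗ 𝒯(B)(3) → 𝒯(A ⊗ B ⊗ χ)(3)`,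
`Ψ(τᵢ(a, a') ⊗ τⱼ(b, b')) = δᵢⱼ (-1)^(|a'||b|) τᵢ(a ⊗ b, a' ⊗ b')`. -/
noncomputable def psi (χ : Equiv.Perm (Fin 2) →* ℤˣ) (A B : GrS2Mod K) :
    A.T3 →ₗ[K] B.T3 →ₗ[K] (tensor χ A B).T3 :=
  LinearMap.mk₂ K (fun s t o => middleSwap A A B B (s o ⊗ₜ[K] t o))
    (fun s s' t => by funext o; simp [add_tmul]) (fun c s t => by funext o; simp [← smul_tmul'])
    (fun s t t' => by funext o; simp [tmul_add]) (fun c s t => by funext o; simp)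

theorem psi_apply (χ : Equiv.Perm (Fin 2) →* ℤˣ) (A B : GrS2Mod K) (s : A.T3) (t : B.T3)
    (o : Fin 3) : psi χ A B s t o = middleSwap A A B B (s o ⊗ₜ[K] t o) := rfl

theorem psi_act (χ : Equiv.Perm (Fin 2) →* ℤˣ) (A B : GrS2Mod K) (σ : Equiv.Perm (Fin 3))
    (s : A.T3) (t : B.T3) : (tensor χ A B).act σ (psi χ A B s t) =
      chi K χ (perm3to2 σ) • psi χ A B (A.act σ s) (B.act σ t) := by
  funext o
  rw [act_apply, Pi.smul_apply, psi_apply, psi_apply, act_apply, act_apply,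
    middleSwap_map _ _ _ _ (A.ρ_deg _) (fun _ _ h => h), TensorProduct.map_id]
  exact LinearMap.congr_fun (TensorProduct.map_smul_right _ _ _) _

theorem psi_deg (χ : Equiv.Perm (Fin 2) →* ℤˣ) (A B : GrS2Mod K) {m n : ℤ}
    {s : A.T3} {t : B.T3} (hs : s ∈ A.T3deg m) (ht : t ∈ B.T3deg n) :
    psi χ A B s t ∈ (tensor χ A B).T3deg (m + n) :=
  fun o _ => middleSwap_mem χ (hs o trivial) (ht o trivial)

theorem psi_map (χ : Equiv.Perm (Fin 2) →* ℤˣ) {A B C D : GrS2Mod K}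
    {f : A.carrier →ₗ[K] C.carrier} {g : B.carrier →ₗ[K] D.carrier} (hf : IsHom f) (hg : IsHom g)
    (s : A.T3) (t : B.T3) :
    T3map (A := tensor χ A B) (B := tensor χ C D) (TensorProduct.map f g) (psi χ A B s t) =
      psi χ C D (T3map f s) (T3map g t) := by
  funext o
  rw [T3map_apply, psi_apply, psi_apply, T3map_apply, T3map_apply,
    middleSwap_map _ _ _ _ hf.deg hg.deg]

theorem psi_assoc (χ : Equiv.Perm (Fin 2) →* ℤˣ) (A B C : GrS2Mod K) (r : A.T3) (s : B.T3)
    (t : C.T3) :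
    T3map (A := tensor χ (tensor χ A B) C) (B := tensor χ A (tensor χ B C))
      (TensorProduct.assoc K A.carrier B.carrier C.carrier).toLinearMap
      (psi χ (tensor χ A B) C (psi χ A B r s) t) =
    psi χ A (tensor χ B C) r (psi χ B C s t) := by
  funext o
  exact middleSwap_assoc χ A B C (r o) (s o) (t o)

theorem psi_assoc_symm (χ : Equiv.Perm (Fin 2) →* ℤˣ) (A B C : GrS2Mod K) (r : A.T3) (s : B.T3)
    (t : C.T3) :
    T3map (A := tensor χ A (tensor χ B C)) (B := tensor χ (tensor χ A B) C)
      (TensorProduct.assoc K A.carrier B.carrier C.carrier).symm.toLinearMap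
      (psi χ A (tensor χ B C) r (psi χ B C s t)) =
    psi χ (tensor χ A B) C (psi χ A B r s) t := by
  rw [← psi_assoc, ← LinearMap.comp_apply, ← T3map_comp, LinearEquiv.symm_comp, T3map_id]
  rfl

/-- The relation `Σₒ a(a(x_{o+1}, x_{o+2}), x_o)` of the unit of the black product. For `χ = sign`,
the generator is a Lie bracket and this is the Jacobi relation. -/
noncomputable def unitRel (K : Type u) [Field K] (χ : Equiv.Perm (Fin 2) →* ℤˣ) : (unit K χ).T3 :=
  tau 0 1 1 + tau 1 1 1 + tau 2 1 1

theorem unitRel_apply (χ : Equiv.Perm (Fin 2) →* ℤˣ) (o : Fin 3) :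
    unitRel K χ o = (1 : K) ⊗ₜ[K] (1 : K) := by
  fin_cases o <;> simp [unitRel, tau]

theorem one_mem_unitDeg : (1 : K) ∈ unitDeg K 0 := by simp [unitDeg]

theorem unitRel_deg (χ : Equiv.Perm (Fin 2) →* ℤˣ) : unitRel K χ ∈ (unit K χ).T3deg 0 := by
  intro o _
  rw [unitRel_apply]
  exact tmul_mem (unit K χ) (unit K χ) (add_zero 0) one_mem_unitDeg one_mem_unitDeg

theorem unitRel_act (χ : Equiv.Perm (Fin 2) →* ℤˣ) (σ : Equiv.Perm (Fin 3)) :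
    (unit K χ).act σ (unitRel K χ) = chi K χ (perm3to2 σ) • unitRel K χ := by
  funext o
  rw [act_apply, Pi.smul_apply, unitRel_apply, unitRel_apply, TensorProduct.map_tmul,
    ← tmul_smul]
  rfl

theorem lid_psi (χ : Equiv.Perm (Fin 2) →* ℤˣ) (A : GrS2Mod K) (s : A.T3) :
    T3map (A := tensor χ (unit K χ) A) (B := A) (TensorProduct.lid K A.carrier).toLinearMap
      (psi χ (unit K χ) A (unitRel K χ) s) = s := by
  funext o
  rw [T3map_apply, psi_apply, unitRel_apply]
  induction s o using tensor_induction with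
  | h0 => simp
  | hadd x y hx hy => simp only [map_add, tmul_add, hx, hy]
  | hh i j a ha a' ha' =>
    rw [middleSwap_tmul (unit K χ) (unit K χ) A A 1 a' one_mem_unitDeg ha]
    simp [ksign_zero]

theorem rid_psi (χ : Equiv.Perm (Fin 2) →* ℤˣ) (A : GrS2Mod K) (s : A.T3) :
    T3map (A := tensor χ A (unit K χ)) (B := A) (TensorProduct.rid K A.carrier).toLinearMap
      (psi χ A (unit K χ) s (unitRel K χ)) = s := by
  funext o
  rw [T3map_apply, psi_apply, unitRel_apply]
  induction s o using tensor_induction with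
  | h0 => simp
  | hadd x y hx hy => simp only [map_add, add_tmul, hx, hy]
  | hh i j a ha a' ha' =>
    rw [middleSwap_tmul A A (unit K χ) (unit K χ) a 1 ha' one_mem_unitDeg]
    simp [ksign_zero]

/-- The `S₂`-invariant elements, `A⁺`. -/
def evenPart (A : GrS2Mod K) : Set A.carrier :=
  {a | ∀ σ, A.ρ σ a = a}

/-- The `S₂`-antiinvariant elements, `A⁻`. -/
def oddPart (A : GrS2Mod K) : Set A.carrier :=
  {a | ∀ σ, A.ρ σ a = chi K Equiv.Perm.sign σ • a}

/-- `(a, b)` lies in `A⁺ × B⁺` or in `A⁻ × B⁻`. -/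
def SameParity {A B : GrS2Mod K} (a : A.carrier) (b : B.carrier) : Prop :=
  (a ∈ A.evenPart ∧ b ∈ B.evenPart) ∨ (a ∈ A.oddPart ∧ b ∈ B.oddPart)

theorem IsHom.even {A B : GrS2Mod K} {f : A.carrier →ₗ[K] B.carrier} (hf : IsHom f)
    {a : A.carrier} (ha : a ∈ A.evenPart) : f a ∈ B.evenPart := fun σ => by
  rw [← hf.equivariant, ha σ]

theorem IsHom.odd {A B : GrS2Mod K} {f : A.carrier →ₗ[K] B.carrier} (hf : IsHom f)
    {a : A.carrier} (ha : a ∈ A.oddPart) : f a ∈ B.oddPart := fun σ => by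
  rw [← hf.equivariant, ha σ, map_smul]

theorem SameParity.map {A B A' B' : GrS2Mod K} {f : A.carrier →ₗ[K] A'.carrier}
    {g : B.carrier →ₗ[K] B'.carrier} (hf : IsHom f) (hg : IsHom g) {a : A.carrier}
    {b : B.carrier} (h : SameParity a b) : SameParity (f a) (g b) :=
  h.imp (fun h => ⟨hf.even h.1, hg.even h.2⟩) (fun h => ⟨hf.odd h.1, hg.odd h.2⟩)

/-- For maps `f : A → D` and `g : B → D`, the `S₃`-submodule of `𝒯(D)(3)` spanned by the elements
`τ₁(f a, g b) + (-1)^(|a||b|) τ₁(g b, f a)` with `a`, `b` homogeneous and `(a, b)` in `A⁺ × B⁺` or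
`A⁻ × B⁻`. -/
def crossRel (A B : GrS2Mod K) {D : GrS2Mod K} (f : A.carrier →ₗ[K] D.carrier)
    (g : B.carrier →ₗ[K] D.carrier) : Submodule K D.T3 :=
  Submodule.span K {t | ∃ (σ : Equiv.Perm (Fin 3)) (i j : ℤ) (a : A.carrier) (b : B.carrier),
    a ∈ A.deg i ∧ b ∈ B.deg j ∧ SameParity a b ∧
    t = D.act σ (tau 2 (f a) (g b) + ksign K (i * j) • tau 2 (g b) (f a))}

/-- The `S₃`-submodule `{A, B}` of `𝒯(A ⊕ B)(3)`, spanned by the elements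
`τ₁(a, b) + (-1)^(|a||b|) τ₁(b, a)` with `(a, b)` in `A⁺ × B⁺` or `A⁻ × B⁻`. -/
noncomputable def bracket (A B : GrS2Mod K) : Submodule K (directSum A B).T3 :=
  crossRel A B (D := directSum A B) (LinearMap.inl K A.carrier B.carrier)
    (LinearMap.inr K A.carrier B.carrier)

theorem crossRel_act (A B : GrS2Mod K) {D : GrS2Mod K} (f : A.carrier →ₗ[K] D.carrier)
    (g : B.carrier →ₗ[K] D.carrier) (σ : Equiv.Perm (Fin 3)) (t : D.T3)
    (ht : t ∈ crossRel A B f g) : D.act σ t ∈ crossRel A B f g := by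
  have : crossRel A B f g ≤ (crossRel A B f g).comap (D.act σ) := by
    refine Submodule.span_le.2 ?_
    rintro _ ⟨τ, i, j, a, b, ha, hb, hab, rfl⟩
    refine Submodule.subset_span ⟨σ * τ, i, j, a, b, ha, hb, hab, ?_⟩
    rw [map_mul]; rfl
  exact this ht

theorem crossRel_homog (A B : GrS2Mod K) {D : GrS2Mod K} {f : A.carrier →ₗ[K] D.carrier}
    {g : B.carrier →ₗ[K] D.carrier} (hf : IsHom f) (hg : IsHom g) :
    crossRel A B f g ≤ ⨆ n, crossRel A B f g ⊓ D.T3deg n := by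
  refine Submodule.span_le.2 ?_
  rintro t ht
  obtain ⟨σ, i, j, a, b, ha, hb, hab, e⟩ := ht
  refine Submodule.mem_iSup_of_mem (p := fun n => crossRel A B f g ⊓ D.T3deg n) (i + j) ?_
  refine ⟨Submodule.subset_span ⟨σ, i, j, a, b, ha, hb, hab, e⟩, ?_⟩
  rw [e]
  exact act_deg D _ (add_mem (tau_deg D rfl 2 (hf.deg _ _ ha) (hg.deg _ _ hb))
    (Submodule.smul_mem _ _ (tau_deg D (add_comm _ _) 2 (hg.deg _ _ hb) (hf.deg _ _ ha))))

theorem crossRel_map (A B : GrS2Mod K) {D E : GrS2Mod K} (f : A.carrier →ₗ[K] D.carrier)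
    (g : B.carrier →ₗ[K] D.carrier) {h : D.carrier →ₗ[K] E.carrier} (hh : IsHom h) :
    (crossRel A B f g).map (T3map h) ≤ crossRel A B (h ∘ₗ f) (h ∘ₗ g) := by
  rw [Submodule.map_le_iff_le_comap]
  refine Submodule.span_le.2 ?_
  rintro _ ⟨τ, i, j, a, b, ha, hb, hab, rfl⟩
  refine Submodule.subset_span ⟨τ, i, j, a, b, ha, hb, hab, ?_⟩
  rw [T3map_act hh, map_add, map_smul, T3map_tau, T3map_tau]; rfl

theorem crossRel_le_map (A B : GrS2Mod K) {D E : GrS2Mod K} (f : A.carrier →ₗ[K] D.carrier)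
    (g : B.carrier →ₗ[K] D.carrier) {h : D.carrier →ₗ[K] E.carrier} (hh : IsHom h) :
    crossRel A B (h ∘ₗ f) (h ∘ₗ g) ≤ (crossRel A B f g).map (T3map h) := by
  refine Submodule.span_le.2 ?_
  rintro _ ⟨τ, i, j, a, b, ha, hb, hab, rfl⟩
  refine ⟨_, Submodule.subset_span ⟨τ, i, j, a, b, ha, hb, hab, rfl⟩, ?_⟩
  rw [T3map_act hh, map_add, map_smul, T3map_tau, T3map_tau]; rfl

theorem crossRel_comp_le {A B A' B' D : GrS2Mod K} (f : A'.carrier →ₗ[K] D.carrier)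
    (g : B'.carrier →ₗ[K] D.carrier) {h : A.carrier →ₗ[K] A'.carrier}
    {k : B.carrier →ₗ[K] B'.carrier} (hh : IsHom h) (hk : IsHom k) :
    crossRel A B (f ∘ₗ h) (g ∘ₗ k) ≤ crossRel A' B' f g := by
  refine Submodule.span_le.2 ?_
  rintro _ ⟨τ, i, j, a, b, ha, hb, hab, rfl⟩
  exact Submodule.subset_span ⟨τ, i, j, h a, k b, hh.deg _ _ ha, hk.deg _ _ hb,
    hab.map hh hk, rfl⟩

theorem isHom_inl (A B : GrS2Mod K) :
    IsHom (A := A) (B := directSum A B) (LinearMap.inl K A.carrier B.carrier) :=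
  ⟨fun _ _ h => ⟨h, zero_mem _⟩, fun σ x => by
    change _ = ((A.ρ σ x, B.ρ σ 0) : A.carrier × B.carrier)
    simp⟩

theorem isHom_inr (A B : GrS2Mod K) :
    IsHom (A := B) (B := directSum A B) (LinearMap.inr K A.carrier B.carrier) :=
  ⟨fun _ _ h => ⟨zero_mem _, h⟩, fun σ x => by
    change _ = ((A.ρ σ 0, B.ρ σ x) : A.carrier × B.carrier)
    simp⟩

theorem isHom_fst (A B : GrS2Mod K) :
    IsHom (A := directSum A B) (B := A) (LinearMap.fst K A.carrier B.carrier) :=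
  ⟨fun _ _ h => h.1, fun _ _ => rfl⟩

theorem isHom_snd (A B : GrS2Mod K) :
    IsHom (A := directSum A B) (B := B) (LinearMap.snd K A.carrier B.carrier) :=
  ⟨fun _ _ h => h.2, fun _ _ => rfl⟩

theorem crossRel_sum_left_le (A B C : GrS2Mod K) {D : GrS2Mod K}
    (f : A.carrier × B.carrier →ₗ[K] D.carrier) (g : C.carrier →ₗ[K] D.carrier) :
    crossRel (directSum A B) C f g ≤
      crossRel A C (f ∘ₗ LinearMap.inl K A.carrier B.carrier) g ⊔
      crossRel B C (f ∘ₗ LinearMap.inr K A.carrier B.carrier) g := by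
  refine Submodule.span_le.2 ?_
  rintro _ ⟨σ, i, j, ⟨a, b⟩, c, ha, hc, hac, rfl⟩
  refine Submodule.mem_sup.2 ⟨_, Submodule.subset_span ⟨σ, i, j, a, c, ha.1, hc,
    hac.map (isHom_fst A B) (IsHom.id C), rfl⟩, _, Submodule.subset_span ⟨σ, i, j, b, c, ha.2, hc,
    hac.map (isHom_snd A B) (IsHom.id C), rfl⟩, ?_⟩
  have e : f (a, b) = f (a, 0) + f (0, b) := by rw [← map_add]; simp
  rw [← map_add]
  congr 1
  simp only [tau, e, LinearMap.comp_apply, LinearMap.inl_apply, LinearMap.inr_apply, add_tmul,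
    tmul_add, Pi.single_add, smul_add]
  abel

theorem crossRel_sum_right_le (A B C : GrS2Mod K) {D : GrS2Mod K}
    (f : A.carrier →ₗ[K] D.carrier) (g : B.carrier × C.carrier →ₗ[K] D.carrier) :
    crossRel A (directSum B C) f g ≤
      crossRel A B f (g ∘ₗ LinearMap.inl K B.carrier C.carrier) ⊔
      crossRel A C f (g ∘ₗ LinearMap.inr K B.carrier C.carrier) := by
  refine Submodule.span_le.2 ?_
  rintro _ ⟨σ, i, j, a, ⟨b, c⟩, ha, hc, hac, rfl⟩
  refine Submodule.mem_sup.2 ⟨_, Submodule.subset_span ⟨σ, i, j, a, b, ha, hc.1,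
    hac.map (IsHom.id A) (isHom_fst B C), rfl⟩, _, Submodule.subset_span ⟨σ, i, j, a, c, ha, hc.2,
    hac.map (IsHom.id A) (isHom_snd B C), rfl⟩, ?_⟩
  have e : g (b, c) = g (b, 0) + g (0, c) := by rw [← map_add]; simp
  rw [← map_add]
  congr 1
  simp only [tau, e, LinearMap.comp_apply, LinearMap.inl_apply, LinearMap.inr_apply, add_tmul,
    tmul_add, Pi.single_add, smul_add]
  abel

theorem IsHom.coprod {A B C : GrS2Mod K} {f : A.carrier →ₗ[K] C.carrier}
    {g : B.carrier →ₗ[K] C.carrier} (hf : IsHom f) (hg : IsHom g) :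
    IsHom (A := directSum A B) (LinearMap.coprod f g) :=
  ⟨fun n x h => add_mem (hf.deg n _ h.1) (hg.deg n _ h.2), fun σ x => by
    change f (A.ρ σ x.1) + g (B.ρ σ x.2) = C.ρ σ (f x.1 + g x.2)
    rw [hf.equivariant, hg.equivariant, map_add]⟩

theorem IsHom.prod {A B C : GrS2Mod K} {f : C.carrier →ₗ[K] A.carrier}
    {g : C.carrier →ₗ[K] B.carrier} (hf : IsHom f) (hg : IsHom g) :
    IsHom (B := directSum A B) (LinearMap.prod f g) :=
  ⟨fun n x h => ⟨hf.deg n _ h, hg.deg n _ h⟩, fun σ x => by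
    change (f (C.ρ σ x), g (C.ρ σ x)) = (A.ρ σ (f x), B.ρ σ (g x))
    rw [hf.equivariant, hg.equivariant]⟩

theorem IsHom.tensor (χ : Equiv.Perm (Fin 2) →* ℤˣ) {A B C D : GrS2Mod K}
    {f : A.carrier →ₗ[K] C.carrier} {g : B.carrier →ₗ[K] D.carrier} (hf : IsHom f)
    (hg : IsHom g) :
    IsHom (A := tensor χ A B) (B := tensor χ C D) (TensorProduct.map f g) :=
  ⟨fun _ _ h => map_mem_tensorDeg hf.deg hg.deg h, fun σ x => by
    induction x using TensorProduct.induction_on with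
    | zero => simp
    | add x y hx hy => simp only [map_add, hx, hy]
    | tmul a b =>
      rw [tensorRep_tmul, map_smul, TensorProduct.map_tmul, TensorProduct.map_tmul,
        tensorRep_tmul, hf.equivariant, hg.equivariant]⟩

end GrS2Mod

/-- Binary operadic quadratic data: a graded `S₂`-module `gen` of generators and a graded
`S₃`-submodule `rel` of `𝒯(gen)(3)`. The field `rel_homog` says that `rel` is a graded subspace. -/
structure BOQD (K : Type u) [Field K] where
  gen : GrS2Mod K
  rel : Submodule K gen.T3
  rel_act : ∀ (σ : Equiv.Perm (Fin 3)) (t : gen.T3), t ∈ rel → gen.act σ t ∈ rel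
  rel_homog : rel ≤ ⨆ n, rel ⊓ gen.T3deg n

namespace BOQD

open GrS2Mod

variable {K : Type u} [Field K]

/-- Morphisms of binary operadic quadratic data. -/
@[ext]
structure Hom (A B : BOQD K) where
  lin : A.gen.carrier →ₗ[K] B.gen.carrier
  isHom : IsHom lin
  map_rel : ∀ t ∈ A.rel, T3map lin t ∈ B.rel

instance : Category (BOQD K) where
  Hom := Hom
  id A := ⟨LinearMap.id, IsHom.id A.gen, fun t ht => by rw [T3map_id]; exact ht⟩
  comp f g := ⟨g.lin ∘ₗ f.lin, g.isHom.comp f.isHom, fun t ht => by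
    rw [T3map_comp]; exact g.map_rel _ (f.map_rel _ ht)⟩

@[ext]
theorem hom_ext {A B : BOQD K} {f g : A ⟶ B} (h : f.lin = g.lin) : f = g := Hom.ext h

theorem id_lin (A : BOQD K) : Hom.lin (𝟙 A) = LinearMap.id := rfl

theorem comp_lin {A B C : BOQD K} (f : A ⟶ B) (g : B ⟶ C) :
    Hom.lin (f ≫ g) = g.lin ∘ₗ f.lin := rfl

/-- An isomorphism from two morphisms that are inverse to each other on generators. -/
def isoMk {A B : BOQD K} (f : A ⟶ B) (g : B ⟶ A) (h : g.lin ∘ₗ f.lin = LinearMap.id)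
    (h' : f.lin ∘ₗ g.lin = LinearMap.id) : A ≅ B where
  hom := f
  inv := g
  hom_inv_id := hom_ext h
  inv_hom_id := hom_ext h'

/-- The black product `A • B = (A₁ ⊗ B₁ ⊗ χ, Ψ(R(A) ⊗ R(B)))`. The case `χ = sign` is the black
product of Ginzburg–Kapranov and Vallette; in the case `χ = 1` the generators are the plain Hadamard
tensor product `A₁ ⊗ B₁`. -/
noncomputable abbrev black (χ : Equiv.Perm (Fin 2) →* ℤˣ) (A B : BOQD K) : BOQD K where
  gen := tensor χ A.gen B.gen
  rel := Submodule.map₂ (psi χ A.gen B.gen) A.rel B.rel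
  rel_act σ t ht := by
    have : Submodule.map₂ (psi χ A.gen B.gen) A.rel B.rel ≤
        (Submodule.map₂ (psi χ A.gen B.gen) A.rel B.rel).comap ((tensor χ A.gen B.gen).act σ) :=
      Submodule.map₂_le.2 fun r hr s hs => by
        rw [Submodule.mem_comap, psi_act]
        exact Submodule.smul_mem _ _
          (Submodule.apply_mem_map₂ _ (A.rel_act σ r hr) (B.rel_act σ s hs))
    exact this ht
  rel_homog := by
    refine (Submodule.map₂_le_map₂ A.rel_homog B.rel_homog).trans ?_
    rw [Submodule.map₂_iSup_left]
    refine iSup_le fun m => ?_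
    rw [Submodule.map₂_iSup_right]
    refine iSup_le fun n => ?_
    refine le_iSup_of_le (m + n) (le_inf (Submodule.map₂_le_map₂ inf_le_left inf_le_left) ?_)
    exact Submodule.map₂_le.2 fun r hr s hs => psi_deg χ _ _ hr.2 hs.2

/-- The black product of morphisms. -/
noncomputable def blackHom (χ : Equiv.Perm (Fin 2) →* ℤˣ) {A B C D : BOQD K} (f : A ⟶ C)
    (g : B ⟶ D) : black χ A B ⟶ black χ C D where
  lin := TensorProduct.map f.lin g.lin
  isHom := f.isHom.tensor χ g.isHom
  map_rel t ht := by
    have : Submodule.map₂ (psi χ A.gen B.gen) A.rel B.rel ≤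
        (Submodule.map₂ (psi χ C.gen D.gen) C.rel D.rel).comap
          (T3map (A := tensor χ A.gen B.gen) (B := tensor χ C.gen D.gen)
            (TensorProduct.map f.lin g.lin)) :=
      Submodule.map₂_le.2 fun r hr s hs => by
        rw [Submodule.mem_comap, psi_map χ f.isHom g.isHom]
        exact Submodule.apply_mem_map₂ _ (f.map_rel _ hr) (g.map_rel _ hs)
    exact this ht

/-- The unit of the black product. -/
noncomputable abbrev blackUnit (K : Type u) [Field K] (χ : Equiv.Perm (Fin 2) →* ℤˣ) : BOQD K where
  gen := unit K χ
  rel := Submodule.span K {unitRel K χ}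
  rel_act σ t ht := by
    obtain ⟨c, rfl⟩ := Submodule.mem_span_singleton.1 ht
    rw [map_smul, unitRel_act]
    exact Submodule.smul_mem _ _ (Submodule.smul_mem _ _ (Submodule.mem_span_singleton_self _))
  rel_homog := le_iSup_of_le 0 (le_inf le_rfl
    ((Submodule.span_singleton_le_iff_mem _ _).2 (unitRel_deg χ)))

theorem isHom_assoc (χ : Equiv.Perm (Fin 2) →* ℤˣ) (A B C : GrS2Mod K) :
    IsHom (A := tensor χ (tensor χ A B) C) (B := tensor χ A (tensor χ B C))
      (TensorProduct.assoc K A.carrier B.carrier C.carrier).toLinearMap := by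
  constructor
  · intro n x hx
    have h : tensorDeg (tensor χ A B) C n ≤ (tensorDeg A (tensor χ B C) n).comap
        (TensorProduct.assoc K A.carrier B.carrier C.carrier).toLinearMap := by
      refine tensorDeg_le _ _ n fun m k hmk y hy c hc => ?_
      have h' : tensorDeg A B m ≤ (tensorDeg A (tensor χ B C) n).comap
          ((TensorProduct.assoc K A.carrier B.carrier C.carrier).toLinearMap ∘ₗ
            (TensorProduct.mk K _ _).flip c) :=
        tensorDeg_le _ _ m fun i j hij a ha b hb =>
          tmul_mem A (tensor χ B C) (i := i) (j := j + k) (by omega) ha (tmul_mem B C rfl hb hc)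
      exact h' hy
    exact h hx
  · intro σ x
    refine LinearMap.congr_fun (f := (TensorProduct.assoc K A.carrier B.carrier
      C.carrier).toLinearMap ∘ₗ (tensor χ (tensor χ A B) C).ρ σ) (g :=
      (tensor χ A (tensor χ B C)).ρ σ ∘ₗ (TensorProduct.assoc K A.carrier B.carrier
      C.carrier).toLinearMap) (TensorProduct.ext_threefold fun a b c => ?_) x
    rw [LinearMap.comp_apply, LinearMap.comp_apply, LinearEquiv.coe_coe,
      TensorProduct.assoc_tmul, tensorRep_tmul χ (tensor χ A B) C, tensorRep_tmul χ A B,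
      tensorRep_tmul χ A (tensor χ B C), tensorRep_tmul χ B C, ← smul_tmul', tmul_smul, map_smul,
      map_smul, TensorProduct.assoc_tmul]

theorem isHom_assoc_symm (χ : Equiv.Perm (Fin 2) →* ℤˣ) (A B C : GrS2Mod K) :
    IsHom (A := tensor χ A (tensor χ B C)) (B := tensor χ (tensor χ A B) C)
      (TensorProduct.assoc K A.carrier B.carrier C.carrier).symm.toLinearMap := by
  constructor
  · intro n x hx
    have h : tensorDeg A (tensor χ B C) n ≤ (tensorDeg (tensor χ A B) C n).comap
        (TensorProduct.assoc K A.carrier B.carrier C.carrier).symm.toLinearMap := by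
      refine tensorDeg_le _ _ n fun k m hmk a ha y hy => ?_
      have h' : tensorDeg B C m ≤ (tensorDeg (tensor χ A B) C n).comap
          ((TensorProduct.assoc K A.carrier B.carrier C.carrier).symm.toLinearMap ∘ₗ
            (TensorProduct.mk K _ _) a) :=
        tensorDeg_le _ _ m fun i j hij b hb c hc =>
          tmul_mem (tensor χ A B) C (i := k + i) (j := j) (by omega) (tmul_mem A B rfl ha hb) hc
      exact h' hy
    exact h hx
  · intro σ x
    obtain ⟨y, rfl⟩ := (TensorProduct.assoc K A.carrier B.carrier C.carrier).surjective x
    have := (isHom_assoc χ A B C).equivariant σ y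
    have h2 := congrArg (TensorProduct.assoc K A.carrier B.carrier C.carrier).symm this
    refine h2.symm.trans ?_
    refine (LinearEquiv.symm_apply_apply _ _).trans ?_
    exact congrArg _ (LinearEquiv.symm_apply_apply _ _).symm

/-- The associator of the black product, `(a ⊗ b) ⊗ c ↦ a ⊗ (b ⊗ c)`. -/
noncomputable def blackAssoc (χ : Equiv.Perm (Fin 2) →* ℤˣ) (A B C : BOQD K) :
    black χ (black χ A B) C ≅ black χ A (black χ B C) :=
  isoMk
    { lin := (TensorProduct.assoc K A.gen.carrier B.gen.carrier C.gen.carrier).toLinearMap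
      isHom := isHom_assoc χ A.gen B.gen C.gen
      map_rel := fun t ht => by
        have h : (black χ (black χ A B) C).rel ≤ (black χ A (black χ B C)).rel.comap
            (T3map (A := tensor χ (tensor χ A.gen B.gen) C.gen)
              (B := tensor χ A.gen (tensor χ B.gen C.gen))
              (TensorProduct.assoc K A.gen.carrier B.gen.carrier C.gen.carrier).toLinearMap) := by
          refine Submodule.map₂_le.2 fun q hq c hc => ?_
          have h' : (black χ A B).rel ≤ ((black χ A (black χ B C)).rel.comap
            (T3map (A := tensor χ (tensor χ A.gen B.gen) C.gen)
              (B := tensor χ A.gen (tensor χ B.gen C.gen))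
              (TensorProduct.assoc K A.gen.carrier B.gen.carrier C.gen.carrier).toLinearMap)).comap
              ((psi χ (tensor χ A.gen B.gen) C.gen).flip c) := by
            refine Submodule.map₂_le.2 fun a ha b hb => ?_
            exact (congrArg (· ∈ (black χ A (black χ B C)).rel)
              (psi_assoc χ A.gen B.gen C.gen a b c)).mpr
              (Submodule.apply_mem_map₂ _ ha (Submodule.apply_mem_map₂ _ hb hc))
          exact h' hq
        exact h ht }
    { lin := (TensorProduct.assoc K A.gen.carrier B.gen.carrier C.gen.carrier).symm.toLinearMap
      isHom := isHom_assoc_symm χ A.gen B.gen C.gen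
      map_rel := fun t ht => by
        have h : (black χ A (black χ B C)).rel ≤ (black χ (black χ A B) C).rel.comap
            (T3map (A := tensor χ A.gen (tensor χ B.gen C.gen))
              (B := tensor χ (tensor χ A.gen B.gen) C.gen)
              (TensorProduct.assoc K A.gen.carrier B.gen.carrier
                C.gen.carrier).symm.toLinearMap) := by
          refine Submodule.map₂_le.2 fun a ha q hq => ?_
          have h' : (black χ B C).rel ≤ ((black χ (black χ A B) C).rel.comap
            (T3map (A := tensor χ A.gen (tensor χ B.gen C.gen))
              (B := tensor χ (tensor χ A.gen B.gen) C.gen)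
              (TensorProduct.assoc K A.gen.carrier B.gen.carrier
                C.gen.carrier).symm.toLinearMap)).comap
              (psi χ A.gen (tensor χ B.gen C.gen) a) := by
            refine Submodule.map₂_le.2 fun b hb c hc => ?_
            exact (congrArg (· ∈ (black χ (black χ A B) C).rel)
              (psi_assoc_symm χ A.gen B.gen C.gen a b c)).mpr
              (Submodule.apply_mem_map₂ _ (Submodule.apply_mem_map₂ _ ha hb) hc)
          exact h' hq
        exact h ht }
    (LinearEquiv.symm_comp _) (LinearEquiv.comp_symm _)

theorem unitRep_apply (χ : Equiv.Perm (Fin 2) →* ℤˣ) (σ : Equiv.Perm (Fin 2)) (c : K) :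
    unitRep K χ σ c = chi K χ σ * c := rfl

theorem chi_mul_self (χ : Equiv.Perm (Fin 2) →* ℤˣ) (σ : Equiv.Perm (Fin 2)) :
    chi K χ σ * chi K χ σ = 1 := by
  rw [← map_mul, show σ * σ = 1 by revert σ; decide, map_one]

theorem isHom_lid (χ : Equiv.Perm (Fin 2) →* ℤˣ) (A : GrS2Mod K) :
    IsHom (A := tensor χ (unit K χ) A) (B := A) (TensorProduct.lid K A.carrier).toLinearMap := by
  constructor
  · intro n x hx
    have h : tensorDeg (unit K χ) A n ≤
        (A.deg n).comap (TensorProduct.lid K A.carrier).toLinearMap := by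
      refine tensorDeg_le _ _ n fun i j hij c hc a ha => ?_
      by_cases hi : i = 0
      · have : j = n := by omega
        subst this
        exact Submodule.smul_mem _ c ha
      · have : c = 0 := by simpa [unitDeg, hi] using hc
        rw [this, zero_tmul]
        exact zero_mem _
    exact h hx
  · intro σ x
    induction x using TensorProduct.induction_on with
    | zero => simp
    | add x y hx hy => simp only [map_add, hx, hy]
    | tmul c a =>
      rw [tensorRep_tmul χ (unit K χ) A, map_smul, LinearEquiv.coe_coe, TensorProduct.lid_tmul,
        TensorProduct.lid_tmul, map_smul, smul_smul, unitRep_apply, ← mul_assoc, chi_mul_self,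
        one_mul]

theorem isHom_lid_symm (χ : Equiv.Perm (Fin 2) →* ℤˣ) (A : GrS2Mod K) :
    IsHom (A := A) (B := tensor χ (unit K χ) A)
      (TensorProduct.lid K A.carrier).symm.toLinearMap := by
  constructor
  · intro n x hx
    exact tmul_mem (unit K χ) A (zero_add n) one_mem_unitDeg hx
  · intro σ x
    rw [LinearEquiv.coe_coe, TensorProduct.lid_symm_apply, TensorProduct.lid_symm_apply,
      tensorRep_tmul χ (unit K χ) A, unitRep_apply, smul_tmul', smul_eq_mul, ← mul_assoc,
      chi_mul_self, one_mul]

theorem isHom_rid (χ : Equiv.Perm (Fin 2) →* ℤˣ) (A : GrS2Mod K) :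
    IsHom (A := tensor χ A (unit K χ)) (B := A) (TensorProduct.rid K A.carrier).toLinearMap := by
  constructor
  · intro n x hx
    have h : tensorDeg A (unit K χ) n ≤
        (A.deg n).comap (TensorProduct.rid K A.carrier).toLinearMap := by
      refine tensorDeg_le _ _ n fun i j hij a ha c hc => ?_
      by_cases hj : j = 0
      · have : i = n := by omega
        subst this
        exact Submodule.smul_mem _ c ha
      · have : c = 0 := by simpa [unitDeg, hj] using hc
        rw [this, tmul_zero]
        exact zero_mem _
    exact h hx
  · intro σ x
    induction x using TensorProduct.induction_on with
    | zero => simp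
    | add x y hx hy => simp only [map_add, hx, hy]
    | tmul a c =>
      rw [tensorRep_tmul χ A (unit K χ), map_smul, LinearEquiv.coe_coe, TensorProduct.rid_tmul,
        TensorProduct.rid_tmul, map_smul, smul_smul, unitRep_apply, ← mul_assoc, chi_mul_self,
        one_mul]

theorem isHom_rid_symm (χ : Equiv.Perm (Fin 2) →* ℤˣ) (A : GrS2Mod K) :
    IsHom (A := A) (B := tensor χ A (unit K χ))
      (TensorProduct.rid K A.carrier).symm.toLinearMap := by
  constructor
  · intro n x hx
    exact tmul_mem A (unit K χ) (add_zero n) hx one_mem_unitDeg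
  · intro σ x
    rw [LinearEquiv.coe_coe, TensorProduct.rid_symm_apply, TensorProduct.rid_symm_apply,
      tensorRep_tmul χ A (unit K χ), unitRep_apply, ← tmul_smul, smul_eq_mul, ← mul_assoc,
      chi_mul_self, one_mul]

/-- The left unitor of the black product. -/
noncomputable def blackLeftUnitor (χ : Equiv.Perm (Fin 2) →* ℤˣ) (A : BOQD K) :
    black χ (blackUnit K χ) A ≅ A :=
  isoMk
    { lin := (TensorProduct.lid K A.gen.carrier).toLinearMap
      isHom := isHom_lid χ A.gen
      map_rel := fun t ht => by
        have h : (black χ (blackUnit K χ) A).rel ≤ A.rel.comap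
            (T3map (A := tensor χ (unit K χ) A.gen) (B := A.gen)
              (TensorProduct.lid K A.gen.carrier).toLinearMap) := by
          refine Submodule.map₂_le.2 fun u hu a ha => ?_
          obtain ⟨c, rfl⟩ := Submodule.mem_span_singleton.1 hu
          rw [Submodule.mem_comap, map_smul, LinearMap.smul_apply, map_smul, lid_psi]
          exact Submodule.smul_mem _ _ ha
        exact h ht }
    { lin := (TensorProduct.lid K A.gen.carrier).symm.toLinearMap
      isHom := isHom_lid_symm χ A.gen
      map_rel := fun t ht => by
        rw [← lid_psi χ A.gen t, ← LinearMap.comp_apply, ← T3map_comp, LinearEquiv.symm_comp,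
          T3map_id]
        exact Submodule.apply_mem_map₂ _ (Submodule.mem_span_singleton_self _) ht }
    (LinearEquiv.symm_comp _) (LinearEquiv.comp_symm _)

/-- The right unitor of the black product. -/
noncomputable def blackRightUnitor (χ : Equiv.Perm (Fin 2) →* ℤˣ) (A : BOQD K) :
    black χ A (blackUnit K χ) ≅ A :=
  isoMk
    { lin := (TensorProduct.rid K A.gen.carrier).toLinearMap
      isHom := isHom_rid χ A.gen
      map_rel := fun t ht => by
        have h : (black χ A (blackUnit K χ)).rel ≤ A.rel.comap
            (T3map (A := tensor χ A.gen (unit K χ)) (B := A.gen)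
              (TensorProduct.rid K A.gen.carrier).toLinearMap) := by
          refine Submodule.map₂_le.2 fun a ha u hu => ?_
          obtain ⟨c, rfl⟩ := Submodule.mem_span_singleton.1 hu
          rw [Submodule.mem_comap, map_smul, map_smul, rid_psi]
          exact Submodule.smul_mem _ _ ha
        exact h ht }
    { lin := (TensorProduct.rid K A.gen.carrier).symm.toLinearMap
      isHom := isHom_rid_symm χ A.gen
      map_rel := fun t ht => by
        rw [← rid_psi χ A.gen t, ← LinearMap.comp_apply, ← T3map_comp, LinearEquiv.symm_comp,
          T3map_id]
        exact Submodule.apply_mem_map₂ _ ht (Submodule.mem_span_singleton_self _) }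
    (LinearEquiv.symm_comp _) (LinearEquiv.comp_symm _)

/-- The monoidal category `(BOQD, •)`. -/
noncomputable abbrev blackMonoidal (K : Type u) [Field K] (χ : Equiv.Perm (Fin 2) →* ℤˣ) :
    MonoidalCategory (BOQD K) :=
  letI : MonoidalCategoryStruct (BOQD K) :=
    { tensorObj := black χ
      whiskerLeft := fun X _ _ f => blackHom χ (𝟙 X) f
      whiskerRight := fun f Y => blackHom χ f (𝟙 Y)
      tensorHom := fun f g => blackHom χ f g
      tensorUnit := blackUnit K χ
      associator := blackAssoc χ
      leftUnitor := blackLeftUnitor χ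
      rightUnitor := blackRightUnitor χ }
  MonoidalCategory.ofTensorHom
    (id_tensorHom_id := fun _ _ => hom_ext TensorProduct.map_id)
    (id_tensorHom := fun _ _ _ _ => rfl)
    (tensorHom_id := fun _ _ => rfl)
    (tensorHom_comp_tensorHom := fun f₁ f₂ g₁ g₂ =>
      hom_ext (TensorProduct.map_comp g₁.lin g₂.lin f₁.lin f₂.lin).symm)
    (associator_naturality := fun _ _ _ => hom_ext (TensorProduct.ext_threefold fun _ _ _ => rfl))
    (leftUnitor_naturality := fun f => hom_ext (TensorProduct.ext' fun c a =>
      (map_smul f.lin c a).symm))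
    (rightUnitor_naturality := fun f => hom_ext (TensorProduct.ext' fun a c =>
      (map_smul f.lin c a).symm))
    (pentagon := fun _ _ _ _ => hom_ext (TensorProduct.ext_fourfold fun _ _ _ _ => rfl))
    (triangle := fun _ _ => hom_ext (TensorProduct.ext_threefold fun a c b =>
      (TensorProduct.smul_tmul c a b).symm))

/-- The relations `R(A) ⊕ {A₁, B₁} ⊕ R(B)` in `𝒯(A₁ ⊕ B₁)(3)`. -/
noncomputable def circRel (A B : BOQD K) : Submodule K (directSum A.gen B.gen).T3 :=
  A.rel.map (T3map (B := directSum A.gen B.gen) (LinearMap.inl K A.gen.carrier B.gen.carrier)) ⊔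
    bracket A.gen B.gen ⊔
    B.rel.map (T3map (B := directSum A.gen B.gen) (LinearMap.inr K A.gen.carrier B.gen.carrier))

theorem circRel_le {A B : BOQD K} {P : Submodule K (directSum A.gen B.gen).T3}
    (hA : ∀ t ∈ A.rel, T3map (B := directSum A.gen B.gen)
      (LinearMap.inl K A.gen.carrier B.gen.carrier) t ∈ P)
    (hB : ∀ t ∈ B.rel, T3map (B := directSum A.gen B.gen)
      (LinearMap.inr K A.gen.carrier B.gen.carrier) t ∈ P)
    (hAB : bracket A.gen B.gen ≤ P) : circRel A B ≤ P :=
  sup_le (sup_le (Submodule.map_le_iff_le_comap.2 hA) hAB) (Submodule.map_le_iff_le_comap.2 hB)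

theorem inl_mem_circRel {A : BOQD K} (B : BOQD K) {t : A.gen.T3} (ht : t ∈ A.rel) :
    T3map (B := directSum A.gen B.gen) (LinearMap.inl K A.gen.carrier B.gen.carrier) t ∈
      circRel A B :=
  Submodule.mem_sup_left (Submodule.mem_sup_left (Submodule.mem_map_of_mem ht))

theorem inr_mem_circRel (A : BOQD K) {B : BOQD K} {t : B.gen.T3} (ht : t ∈ B.rel) :
    T3map (B := directSum A.gen B.gen) (LinearMap.inr K A.gen.carrier B.gen.carrier) t ∈
      circRel A B :=
  Submodule.mem_sup_right (Submodule.mem_map_of_mem ht)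

theorem bracket_le_circRel (A B : BOQD K) : bracket A.gen B.gen ≤ circRel A B :=
  le_sup_right.trans le_sup_left

/-- The product `A ⊚ B = (A₁ ⊕ B₁, R(A) ⊕ {A₁, B₁} ⊕ R(B))`. -/
noncomputable abbrev circ (A B : BOQD K) : BOQD K where
  gen := directSum A.gen B.gen
  rel := circRel A B
  rel_act σ t ht := by
    have h : circRel A B ≤ (circRel A B).comap ((directSum A.gen B.gen).act σ) := by
      refine circRel_le (fun t ht => ?_) (fun t ht => ?_) (fun t ht => ?_)
      · rw [Submodule.mem_comap, ← T3map_act (isHom_inl A.gen B.gen)]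
        exact inl_mem_circRel B (A.rel_act σ t ht)
      · rw [Submodule.mem_comap, ← T3map_act (isHom_inr A.gen B.gen)]
        exact inr_mem_circRel A (B.rel_act σ t ht)
      · exact bracket_le_circRel A B (crossRel_act A.gen B.gen _ _ σ t ht)
    exact h ht
  rel_homog := by
    refine circRel_le (fun t ht => ?_) (fun t ht => ?_) ?_
    · have h : A.rel ≤ (⨆ n, circRel A B ⊓ (directSum A.gen B.gen).T3deg n).comap
          (T3map (B := directSum A.gen B.gen)
            (LinearMap.inl K A.gen.carrier B.gen.carrier)) :=
        A.rel_homog.trans <| iSup_le fun n t ht =>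
          Submodule.mem_iSup_of_mem (p := fun n => circRel A B ⊓ (directSum A.gen B.gen).T3deg n) n
            ⟨inl_mem_circRel B ht.1, T3map_deg (isHom_inl A.gen B.gen) ht.2⟩
      exact h ht
    · have h : B.rel ≤ (⨆ n, circRel A B ⊓ (directSum A.gen B.gen).T3deg n).comap
          (T3map (B := directSum A.gen B.gen)
            (LinearMap.inr K A.gen.carrier B.gen.carrier)) :=
        B.rel_homog.trans <| iSup_le fun n t ht =>
          Submodule.mem_iSup_of_mem (p := fun n => circRel A B ⊓ (directSum A.gen B.gen).T3deg n) n
            ⟨inr_mem_circRel A ht.1, T3map_deg (isHom_inr A.gen B.gen) ht.2⟩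
      exact h ht
    · exact (crossRel_homog A.gen B.gen (isHom_inl _ _) (isHom_inr _ _)).trans
        (iSup_mono fun n => inf_le_inf_right _ (bracket_le_circRel A B))

theorem map_rel_of_circ {A B D : BOQD K}
    {h : A.gen.carrier × B.gen.carrier →ₗ[K] D.gen.carrier}
    (hh : IsHom (A := directSum A.gen B.gen) h)
    {f : A.gen.carrier →ₗ[K] D.gen.carrier} {g : B.gen.carrier →ₗ[K] D.gen.carrier}
    (hf : h ∘ₗ LinearMap.inl K A.gen.carrier B.gen.carrier = f)
    (hg : h ∘ₗ LinearMap.inr K A.gen.carrier B.gen.carrier = g)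
    (hA : ∀ t ∈ A.rel, T3map f t ∈ D.rel) (hB : ∀ t ∈ B.rel, T3map g t ∈ D.rel)
    (hAB : crossRel A.gen B.gen f g ≤ D.rel) :
    ∀ t ∈ circRel A B, T3map (A := directSum A.gen B.gen) h t ∈ D.rel := by
  have key : circRel A B ≤ D.rel.comap (T3map (A := directSum A.gen B.gen) h) := by
    subst hf hg
    refine circRel_le (fun t ht => ?_) (fun t ht => ?_) ?_
    · rw [Submodule.mem_comap, ← LinearMap.comp_apply, ← T3map_comp]
      exact hA t ht
    · rw [Submodule.mem_comap, ← LinearMap.comp_apply, ← T3map_comp]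
      exact hB t ht
    · exact Submodule.map_le_iff_le_comap.1 ((crossRel_map A.gen B.gen _ _ hh).trans hAB)
  exact fun t ht => key ht

theorem crossRel_inl_le {A B : GrS2Mod K} {D : BOQD K} (E : BOQD K)
    {f : A.carrier →ₗ[K] D.gen.carrier} {g : B.carrier →ₗ[K] D.gen.carrier}
    (h : crossRel A B f g ≤ D.rel) :
    crossRel A B (D := directSum D.gen E.gen)
      (LinearMap.inl K D.gen.carrier E.gen.carrier ∘ₗ f)
      (LinearMap.inl K D.gen.carrier E.gen.carrier ∘ₗ g) ≤ circRel D E :=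
  (crossRel_le_map A B f g (isHom_inl D.gen E.gen)).trans
    ((Submodule.map_mono h).trans (le_sup_left.trans le_sup_left))

theorem crossRel_inr_le {A B : GrS2Mod K} (D : BOQD K) {E : BOQD K}
    {f : A.carrier →ₗ[K] E.gen.carrier} {g : B.carrier →ₗ[K] E.gen.carrier}
    (h : crossRel A B f g ≤ E.rel) :
    crossRel A B (D := directSum D.gen E.gen)
      (LinearMap.inr K D.gen.carrier E.gen.carrier ∘ₗ f)
      (LinearMap.inr K D.gen.carrier E.gen.carrier ∘ₗ g) ≤ circRel D E :=
  (crossRel_le_map A B f g (isHom_inr D.gen E.gen)).trans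
    ((Submodule.map_mono h).trans le_sup_right)

theorem crossRel_inl_inr_le {A B : GrS2Mod K} (D E : BOQD K)
    {f : A.carrier →ₗ[K] D.gen.carrier} {g : B.carrier →ₗ[K] E.gen.carrier}
    (hf : IsHom f) (hg : IsHom g) :
    crossRel A B (D := directSum D.gen E.gen)
      (LinearMap.inl K D.gen.carrier E.gen.carrier ∘ₗ f)
      (LinearMap.inr K D.gen.carrier E.gen.carrier ∘ₗ g) ≤ circRel D E :=
  (crossRel_comp_le (D := directSum D.gen E.gen) (LinearMap.inl K D.gen.carrier E.gen.carrier)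
    (LinearMap.inr K D.gen.carrier E.gen.carrier) hf hg).trans (bracket_le_circRel D E)

theorem T3map_comp_mem {A B D : GrS2Mod K} {P : Submodule K D.T3} {f : B.carrier →ₗ[K] D.carrier}
    {g : A.carrier →ₗ[K] B.carrier} {t : A.T3} (h : T3map f (T3map g t) ∈ P) :
    T3map (f ∘ₗ g) t ∈ P := by
  rw [T3map_comp]; exact h

/-- The product `⊚` of morphisms. -/
noncomputable def circHom {A B C D : BOQD K} (f : A ⟶ C) (g : B ⟶ D) : circ A B ⟶ circ C D where
  lin := LinearMap.prodMap f.lin g.lin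
  isHom := (f.isHom.comp (isHom_fst A.gen B.gen)).prod (g.isHom.comp (isHom_snd A.gen B.gen))
  map_rel := map_rel_of_circ (D := circ C D)
    ((f.isHom.comp (isHom_fst A.gen B.gen)).prod (g.isHom.comp (isHom_snd A.gen B.gen)))
    (f := LinearMap.inl K C.gen.carrier D.gen.carrier ∘ₗ f.lin)
    (g := LinearMap.inr K C.gen.carrier D.gen.carrier ∘ₗ g.lin)
    (by ext <;> simp) (by ext <;> simp)
    (fun t ht => T3map_comp_mem (inl_mem_circRel D (f.map_rel t ht)))
    (fun t ht => T3map_comp_mem (inr_mem_circRel C (g.map_rel t ht)))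
    (crossRel_inl_inr_le C D f.isHom g.isHom)

/-- The unit `(0, 0)` of `⊚`. -/
noncomputable abbrev circUnit (K : Type u) [Field K] : BOQD K where
  gen := zero K
  rel := ⊥
  rel_act σ t ht := by
    rw [(Submodule.mem_bot K).1 ht, map_zero]; exact zero_mem _
  rel_homog := bot_le

theorem isHom_prodAssoc (A B C : GrS2Mod K) :
    IsHom (A := directSum (directSum A B) C) (B := directSum A (directSum B C))
      (LinearEquiv.prodAssoc K A.carrier B.carrier C.carrier).toLinearMap :=
  ⟨fun _ _ h => ⟨h.1.1, h.1.2, h.2⟩, fun _ _ => rfl⟩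

theorem isHom_prodAssoc_symm (A B C : GrS2Mod K) :
    IsHom (A := directSum A (directSum B C)) (B := directSum (directSum A B) C)
      (LinearEquiv.prodAssoc K A.carrier B.carrier C.carrier).symm.toLinearMap :=
  ⟨fun _ _ h => ⟨⟨h.1, h.2.1⟩, h.2.2⟩, fun _ _ => rfl⟩

theorem crossRel_le_of_eq {A B D : GrS2Mod K} {f f' : A.carrier →ₗ[K] D.carrier}
    {g g' : B.carrier →ₗ[K] D.carrier} {P : Submodule K D.T3} (hf : f = f') (hg : g = g')
    (h : crossRel A B f' g' ≤ P) : crossRel A B f g ≤ P := by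
  rw [hf, hg]; exact h

theorem crossRel_inl_left_le {B : GrS2Mod K} (D E : BOQD K) {g : B.carrier →ₗ[K] E.gen.carrier}
    (hg : IsHom g) :
    crossRel D.gen B (D := directSum D.gen E.gen) (LinearMap.inl K D.gen.carrier E.gen.carrier)
      (LinearMap.inr K D.gen.carrier E.gen.carrier ∘ₗ g) ≤ circRel D E :=
  crossRel_le_of_eq (D := directSum D.gen E.gen) (LinearMap.comp_id _).symm rfl
    (crossRel_inl_inr_le D E (IsHom.id D.gen) hg)

theorem crossRel_inr_right_le {A : GrS2Mod K} (D E : BOQD K) {f : A.carrier →ₗ[K] D.gen.carrier}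
    (hf : IsHom f) :
    crossRel A E.gen (D := directSum D.gen E.gen)
      (LinearMap.inl K D.gen.carrier E.gen.carrier ∘ₗ f)
      (LinearMap.inr K D.gen.carrier E.gen.carrier) ≤ circRel D E :=
  crossRel_le_of_eq (D := directSum D.gen E.gen) rfl (LinearMap.comp_id _).symm
    (crossRel_inl_inr_le D E hf (IsHom.id E.gen))

theorem crossRel_assoc (A B C : BOQD K) :
    crossRel (directSum A.gen B.gen) C.gen (D := directSum A.gen (directSum B.gen C.gen))
      ((LinearEquiv.prodAssoc K A.gen.carrier B.gen.carrier C.gen.carrier).toLinearMap ∘ₗ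
        LinearMap.inl K (A.gen.carrier × B.gen.carrier) C.gen.carrier)
      (LinearMap.inr K A.gen.carrier (B.gen.carrier × C.gen.carrier) ∘ₗ
        LinearMap.inr K B.gen.carrier C.gen.carrier) ≤ circRel A (circ B C) := by
  have h1 : crossRel A.gen C.gen (D := directSum A.gen (directSum B.gen C.gen))
      (LinearMap.inl K A.gen.carrier (B.gen.carrier × C.gen.carrier))
      (LinearMap.inr K A.gen.carrier (B.gen.carrier × C.gen.carrier) ∘ₗ
        LinearMap.inr K B.gen.carrier C.gen.carrier) ≤ circRel A (circ B C) :=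
    crossRel_inl_left_le A (circ B C) (isHom_inr B.gen C.gen)
  have h2 : crossRel B.gen C.gen (D := directSum A.gen (directSum B.gen C.gen))
      (LinearMap.inr K A.gen.carrier (B.gen.carrier × C.gen.carrier) ∘ₗ
        LinearMap.inl K B.gen.carrier C.gen.carrier)
      (LinearMap.inr K A.gen.carrier (B.gen.carrier × C.gen.carrier) ∘ₗ
        LinearMap.inr K B.gen.carrier C.gen.carrier) ≤ circRel A (circ B C) :=
    crossRel_inr_le A (E := circ B C) (bracket_le_circRel B C)
  exact (crossRel_sum_left_le A.gen B.gen C.gen (D := directSum A.gen (directSum B.gen C.gen))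
        _ _).trans (sup_le h1 h2)

theorem crossRel_assoc_symm (A B C : BOQD K) :
    crossRel A.gen (directSum B.gen C.gen) (D := directSum (directSum A.gen B.gen) C.gen)
      (LinearMap.inl K (A.gen.carrier × B.gen.carrier) C.gen.carrier ∘ₗ
        LinearMap.inl K A.gen.carrier B.gen.carrier)
      ((LinearEquiv.prodAssoc K A.gen.carrier B.gen.carrier C.gen.carrier).symm.toLinearMap ∘ₗ
        LinearMap.inr K A.gen.carrier (B.gen.carrier × C.gen.carrier)) ≤
      circRel (circ A B) C := by
  have h1 : crossRel A.gen C.gen (D := directSum (directSum A.gen B.gen) C.gen)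
      (LinearMap.inl K (A.gen.carrier × B.gen.carrier) C.gen.carrier ∘ₗ
        LinearMap.inl K A.gen.carrier B.gen.carrier)
      (LinearMap.inr K (A.gen.carrier × B.gen.carrier) C.gen.carrier) ≤ circRel (circ A B) C :=
    crossRel_inr_right_le (circ A B) C (isHom_inl A.gen B.gen)
  have h2 : crossRel A.gen B.gen (D := directSum (directSum A.gen B.gen) C.gen)
      (LinearMap.inl K (A.gen.carrier × B.gen.carrier) C.gen.carrier ∘ₗ
        LinearMap.inl K A.gen.carrier B.gen.carrier)
      (LinearMap.inl K (A.gen.carrier × B.gen.carrier) C.gen.carrier ∘ₗ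
        LinearMap.inr K A.gen.carrier B.gen.carrier) ≤ circRel (circ A B) C :=
    crossRel_inl_le (D := circ A B) C (bracket_le_circRel A B)
  exact (crossRel_sum_right_le A.gen B.gen C.gen (D := directSum (directSum A.gen B.gen) C.gen)
        _ _).trans (sup_le h2 h1)

theorem circAssoc_left (A B C : BOQD K) : ∀ t ∈ circRel A B,
    T3map (A := directSum A.gen B.gen) (B := directSum A.gen (directSum B.gen C.gen))
      ((LinearEquiv.prodAssoc K A.gen.carrier B.gen.carrier C.gen.carrier).toLinearMap ∘ₗ
        LinearMap.inl K (A.gen.carrier × B.gen.carrier) C.gen.carrier) t ∈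
      circRel A (circ B C) :=
  map_rel_of_circ (A := A) (B := B) (D := circ A (circ B C))
    (f := LinearMap.inl K A.gen.carrier (B.gen.carrier × C.gen.carrier))
    (g := LinearMap.inr K A.gen.carrier (B.gen.carrier × C.gen.carrier) ∘ₗ
      LinearMap.inl K B.gen.carrier C.gen.carrier)
    ((isHom_prodAssoc A.gen B.gen C.gen).comp (isHom_inl (directSum A.gen B.gen) C.gen))
    rfl rfl (fun _ ht => inl_mem_circRel (circ B C) ht)
    (fun _ ht => T3map_comp_mem (B := directSum B.gen C.gen)
      (D := directSum A.gen (directSum B.gen C.gen))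
      (inr_mem_circRel A (B := circ B C) (inl_mem_circRel C ht)))
    (crossRel_inl_left_le A (circ B C) (isHom_inl B.gen C.gen))

theorem circAssoc_right (A B C : BOQD K) : ∀ t ∈ circRel B C,
    T3map (A := directSum B.gen C.gen) (B := directSum (directSum A.gen B.gen) C.gen)
      ((LinearEquiv.prodAssoc K A.gen.carrier B.gen.carrier C.gen.carrier).symm.toLinearMap ∘ₗ
        LinearMap.inr K A.gen.carrier (B.gen.carrier × C.gen.carrier)) t ∈
      circRel (circ A B) C :=
  map_rel_of_circ (A := B) (B := C) (D := circ (circ A B) C)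
    (f := LinearMap.inl K (A.gen.carrier × B.gen.carrier) C.gen.carrier ∘ₗ
      LinearMap.inr K A.gen.carrier B.gen.carrier)
    (g := LinearMap.inr K (A.gen.carrier × B.gen.carrier) C.gen.carrier)
    ((isHom_prodAssoc_symm A.gen B.gen C.gen).comp (isHom_inr A.gen (directSum B.gen C.gen)))
    rfl rfl
    (fun _ ht => T3map_comp_mem (B := directSum A.gen B.gen)
      (D := directSum (directSum A.gen B.gen) C.gen)
      (inl_mem_circRel (A := circ A B) C (inr_mem_circRel A ht)))
    (fun _ ht => inr_mem_circRel (circ A B) ht)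
    (crossRel_inr_right_le (circ A B) C (isHom_inr A.gen B.gen))

theorem inr_inr_mem (A B C : BOQD K) : ∀ t ∈ C.rel,
    T3map (A := C.gen) (B := directSum A.gen (directSum B.gen C.gen))
      (LinearMap.inr K A.gen.carrier (B.gen.carrier × C.gen.carrier) ∘ₗ
        LinearMap.inr K B.gen.carrier C.gen.carrier) t ∈ circRel A (circ B C) :=
  fun _ ht => T3map_comp_mem (B := directSum B.gen C.gen)
    (D := directSum A.gen (directSum B.gen C.gen))
    (inr_mem_circRel A (B := circ B C) (inr_mem_circRel B ht))

theorem inl_inl_mem (A B C : BOQD K) : ∀ t ∈ A.rel,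
    T3map (A := A.gen) (B := directSum (directSum A.gen B.gen) C.gen)
      (LinearMap.inl K (A.gen.carrier × B.gen.carrier) C.gen.carrier ∘ₗ
        LinearMap.inl K A.gen.carrier B.gen.carrier) t ∈ circRel (circ A B) C :=
  fun _ ht => T3map_comp_mem (B := directSum A.gen B.gen)
    (D := directSum (directSum A.gen B.gen) C.gen)
    (inl_mem_circRel (A := circ A B) C (inl_mem_circRel B ht))

/-- The associator of `⊚`. -/
noncomputable def circAssocHom (A B C : BOQD K) : circ (circ A B) C ⟶ circ A (circ B C) where
  lin := (LinearEquiv.prodAssoc K A.gen.carrier B.gen.carrier C.gen.carrier).toLinearMap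
  isHom := isHom_prodAssoc A.gen B.gen C.gen
  map_rel :=
    map_rel_of_circ (A := circ A B) (B := C) (D := circ A (circ B C))
      (isHom_prodAssoc A.gen B.gen C.gen) rfl rfl (circAssoc_left A B C)
      (inr_inr_mem A B C) (crossRel_assoc A B C)

/-- The inverse of the associator of `⊚`. -/
noncomputable def circAssocInv (A B C : BOQD K) : circ A (circ B C) ⟶ circ (circ A B) C where
  lin := (LinearEquiv.prodAssoc K A.gen.carrier B.gen.carrier C.gen.carrier).symm.toLinearMap
  isHom := isHom_prodAssoc_symm A.gen B.gen C.gen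
  map_rel :=
    map_rel_of_circ (A := A) (B := circ B C) (D := circ (circ A B) C)
      (isHom_prodAssoc_symm A.gen B.gen C.gen) rfl rfl
      (inl_inl_mem A B C) (circAssoc_right A B C) (crossRel_assoc_symm A B C)

/-- The associator of `⊚`, `((a, b), c) ↦ (a, (b, c))`. -/
noncomputable def circAssoc (A B C : BOQD K) : circ (circ A B) C ≅ circ A (circ B C) :=
  isoMk (circAssocHom A B C) (circAssocInv A B C)
    (LinearEquiv.symm_comp _) (LinearEquiv.comp_symm _)

theorem crossRel_zero_left (A : GrS2Mod K) {D : GrS2Mod K}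
    (f : (zero K).carrier →ₗ[K] D.carrier) (g : A.carrier →ₗ[K] D.carrier) :
    crossRel (zero K) A f g = ⊥ := by
  refine le_bot_iff.1 (Submodule.span_le.2 ?_)
  rintro _ ⟨σ, i, j, a, b, ha, hb, hab, rfl⟩
  have : f a = 0 := map_zero f
  simp [this, tau]

theorem crossRel_zero_right (A : GrS2Mod K) {D : GrS2Mod K}
    (f : A.carrier →ₗ[K] D.carrier) (g : (zero K).carrier →ₗ[K] D.carrier) :
    crossRel A (zero K) f g = ⊥ := by
  refine le_bot_iff.1 (Submodule.span_le.2 ?_)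
  rintro _ ⟨σ, i, j, a, b, ha, hb, hab, rfl⟩
  have : g b = 0 := map_zero g
  simp [this, tau]

/-- The left unitor of `⊚`. -/
noncomputable def circLeftUnitor (A : BOQD K) : circ (circUnit K) A ≅ A :=
  isoMk
    { lin := LinearMap.snd K (zero K).carrier A.gen.carrier
      isHom := isHom_snd (zero K) A.gen
      map_rel := map_rel_of_circ (A := circUnit K) (isHom_snd (zero K) A.gen) rfl
        (g := LinearMap.id) rfl
        (fun t ht => by rw [(Submodule.mem_bot K).1 ht, map_zero]; exact zero_mem _)
        (fun t ht => by rw [T3map_id]; exact ht)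
        (by rw [crossRel_zero_left]; exact bot_le) }
    { lin := LinearMap.inr K (zero K).carrier A.gen.carrier
      isHom := isHom_inr (zero K) A.gen
      map_rel := fun t ht => inr_mem_circRel (circUnit K) ht }
    (LinearMap.ext fun _ => rfl) rfl

/-- The right unitor of `⊚`. -/
noncomputable def circRightUnitor (A : BOQD K) : circ A (circUnit K) ≅ A :=
  isoMk
    { lin := LinearMap.fst K A.gen.carrier (zero K).carrier
      isHom := isHom_fst A.gen (zero K)
      map_rel := map_rel_of_circ (B := circUnit K) (isHom_fst A.gen (zero K))
        (f := LinearMap.id) rfl rfl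
        (fun t ht => by rw [T3map_id]; exact ht)
        (fun t ht => by rw [(Submodule.mem_bot K).1 ht, map_zero]; exact zero_mem _)
        (by rw [crossRel_zero_right]; exact bot_le) }
    { lin := LinearMap.inl K A.gen.carrier (zero K).carrier
      isHom := isHom_inl A.gen (zero K)
      map_rel := fun t ht => inl_mem_circRel (circUnit K) ht }
    (LinearMap.ext fun _ => rfl) rfl

/-- The monoidal category `(BOQD, ⊚)`. -/
noncomputable abbrev circMonoidal (K : Type u) [Field K] : MonoidalCategory (BOQD K) :=
  letI : MonoidalCategoryStruct (BOQD K) :=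
    { tensorObj := circ
      whiskerLeft := fun X _ _ f => circHom (𝟙 X) f
      whiskerRight := fun f Y => circHom f (𝟙 Y)
      tensorHom := fun f g => circHom f g
      tensorUnit := circUnit K
      associator := circAssoc
      leftUnitor := circLeftUnitor
      rightUnitor := circRightUnitor }
  MonoidalCategory.ofTensorHom
    (id_tensorHom_id := fun _ _ => rfl)
    (id_tensorHom := fun _ _ _ _ => rfl)
    (tensorHom_id := fun _ _ => rfl)
    (tensorHom_comp_tensorHom := fun _ _ _ _ => rfl)
    (associator_naturality := fun _ _ _ => rfl)
    (leftUnitor_naturality := fun _ => rfl)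
    (rightUnitor_naturality := fun _ => rfl)
    (pentagon := fun _ _ _ _ => rfl)
    (triangle := fun _ _ => hom_ext (LinearMap.ext fun _ => rfl))

end BOQD

/-- For monoidal structures `M = ⊠` and `N = ⊗` on `C`, the maps
`φ : (A ⊗ A') ⊠ (B ⊗ B') ⟶ (A ⊠ B) ⊗ (A' ⊠ B')` are the interchange law of a lax 2-monoidal
category `(C, ⊠, ⊗, φ)`: they make `⊗ : (C, ⊠)² ⥤ (C, ⊠)` a lax monoidal functor, for some unit
morphism `I_⊠ ⟶ I_⊠ ⊗ I_⊠`. -/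
def IsLaxTwoMonoidal {C : Type*} [Category C] (M N : MonoidalCategory C)
    (φ : ∀ A A' B B' : C, M.tensorObj (N.tensorObj A A') (N.tensorObj B B') ⟶
      N.tensorObj (M.tensorObj A B) (M.tensorObj A' B')) : Prop :=
  letI := M
  ∃ L : (@MonoidalCategory.tensor C _ N).LaxMonoidal,
    ∀ A A' B B', L.μ (A, A') (B, B') = φ A A' B B'

/-- For monoidal structures `M = ⊠` and `N = ⊗` on `C`, the maps
`ψ : (A ⊠ B) ⊗ (A' ⊠ B') ⟶ (A ⊗ A') ⊠ (B ⊗ B')` are the interchange law of a colax 2-monoidal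
category `(C, ⊠, ⊗, ψ)`: they make `⊗ : (C, ⊠)² ⥤ (C, ⊠)` a colax monoidal functor, for some counit
morphism `I_⊠ ⊗ I_⊠ ⟶ I_⊠`. -/
def IsColaxTwoMonoidal {C : Type*} [Category C] (M N : MonoidalCategory C)
    (ψ : ∀ A A' B B' : C, N.tensorObj (M.tensorObj A B) (M.tensorObj A' B') ⟶
      M.tensorObj (N.tensorObj A A') (N.tensorObj B B')) : Prop :=
  letI := M
  ∃ L : (@MonoidalCategory.tensor C _ N).OplaxMonoidal,
    ∀ A A' B B', L.δ (A, A') (B, B') = ψ A A' B B'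

/-- The interchange law of graded `S₂`-modules: the projection of
`(A ⊕ A') ⊗ (B ⊕ B') = A ⊗ B ⊕ A' ⊗ B ⊕ A ⊗ B' ⊕ A' ⊗ B'` onto `A ⊗ B ⊕ A' ⊗ B'`. -/
noncomputable def GrS2Mod.pr14 {K : Type u} [Field K] (A A' B B' : GrS2Mod K) :
    (A.carrier × A'.carrier) ⊗[K] (B.carrier × B'.carrier) →ₗ[K]
      (A.carrier ⊗[K] B.carrier) × (A'.carrier ⊗[K] B'.carrier) :=
  LinearMap.prod
    (TensorProduct.map (LinearMap.fst K A.carrier A'.carrier) (LinearMap.fst K B.carrier B'.carrier))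
    (TensorProduct.map (LinearMap.snd K A.carrier A'.carrier) (LinearMap.snd K B.carrier B'.carrier))

/-!
The projection `φ = pr14` is a morphism because, on relations, it sees only products of two brackets
and products of matching summands. Write `p₁`, `p₂` for the two projections of a sum of graded
`S₂`-modules. Both are morphisms of binary operadic quadratic data `A ⊚ A' ⟶ A`, `A ⊚ A' ⟶ A'`
(`T3map_fst_mem`, `T3map_snd_mem`), since each of them kills one of the two entries of every bracket
relation.

* If one factor is a relation of the summand `A`, then `φ ∘ (inl ⊗ id) = inl ∘ (id ⊗ p₁)` and the
  naturality of `Ψ` put the image in `R(A • B)`. The same holds for the three other outer summands.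
* If both factors are bracket relations, each is a multiple of
  `τₒ(a, a') + (-1)^(|a||a'|) τₒ(a', a)` for some tree `o` (`act_tau_add_tau`), and `Ψ` vanishes
  unless the two trees agree. If they do, `φ` discards the two mixed terms among the four, and what
  remains is a sign times `τₒ(a ⊗ b, a' ⊗ b') + (-1)^(|a ⊗ b||a' ⊗ b'|) τₒ(a' ⊗ b', a ⊗ b)`. The
  elements `a ⊗ b` and `a' ⊗ b'` have the same parity, so this is a bracket relation of
  `(A • B) ⊚ (A' • B')` (`T3map_pr14_psi_crossTerm_mem`).

The unit morphism of the lax structure is the diagonal `χ → χ ⊕ χ`: the image of `Σₒ τₒ(e, e)` is the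
sum of its copies in the two summands and of the bracket relations of the two generators
(`T3map_diag_unitRel`). The one of the colax structure is zero. The coherence laws only involve
linear maps on tensor products of direct sums, where they are checked on pure tensors.
-/

namespace GrS2Mod

variable {K : Type u} [Field K]

/-! ### Trees and bracket relations -/

theorem tau_smul_right {A : GrS2Mod K} (o : Fin 3) (c : K) (x y : A.carrier) :
    tau o x (c • y) = c • tau o x y := by
  simp [tau, tmul_smul, Pi.single_smul]

theorem tau_zero_left {A : GrS2Mod K} (o : Fin 3) (x : A.carrier) : tau o 0 x = 0 := by
  simp [tau]

theorem psi_tau_self (χ : Equiv.Perm (Fin 2) →* ℤˣ) (A B : GrS2Mod K) {i j : ℤ} (o : Fin 3)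
    (a : A.carrier) {a' : A.carrier} {b : B.carrier} (b' : B.carrier) (ha' : a' ∈ A.deg i)
    (hb : b ∈ B.deg j) :
    psi χ A B (tau o a a') (tau o b b') =
      ksign K (i * j) • tau (A := tensor χ A B) o (a ⊗ₜ b) (a' ⊗ₜ b') := by
  funext p
  rw [psi_apply, Pi.smul_apply, tau, tau, tau]
  by_cases h : p = o
  · subst h
    rw [Pi.single_eq_same, Pi.single_eq_same, Pi.single_eq_same,
      middleSwap_tmul A A B B a b' ha' hb]
  · simp [Pi.single_eq_of_ne h]

theorem psi_tau_of_ne (χ : Equiv.Perm (Fin 2) →* ℤˣ) (A B : GrS2Mod K) {o o' : Fin 3}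
    (h : o ≠ o') (a a' : A.carrier) (b b' : B.carrier) :
    psi χ A B (tau o a a') (tau o' b b') = 0 := by
  funext p
  rw [psi_apply, tau, tau]
  by_cases hp : p = o
  · have hp' : p ≠ o' := fun e => h (hp.symm.trans e)
    simp [Pi.single_eq_of_ne hp']
  · simp [Pi.single_eq_of_ne hp]

/-- The element `τₒ(f a, g b) + (-1)^(ij) τₒ(g b, f a)`, where `i` and `j` stand for the degrees of
`a` and `b`. -/
noncomputable def crossTerm {A B D : GrS2Mod K} (f : A.carrier →ₗ[K] D.carrier)
    (g : B.carrier →ₗ[K] D.carrier) (o : Fin 3) (i j : ℤ) (a : A.carrier) (b : B.carrier) : D.T3 :=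
  tau o (f a) (g b) + ksign K (i * j) • tau o (g b) (f a)

/-- Permuting the variables of a bracket relation moves it to another tree, up to a scalar: elements
of equal parity pick up the same sign. -/
theorem act_tau_add_tau {A B D : GrS2Mod K} {f : A.carrier →ₗ[K] D.carrier}
    {g : B.carrier →ₗ[K] D.carrier} (hf : IsHom f) (hg : IsHom g) {a : A.carrier} {b : B.carrier}
    (hab : SameParity a b) (i j : ℤ) (σ : Equiv.Perm (Fin 3)) :
    ∃ c : K, D.act σ (tau 2 (f a) (g b) + ksign K (i * j) • tau 2 (g b) (f a)) =
      c • crossTerm f g (σ 2) i j a b := by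
  obtain ⟨c, ha, hb⟩ : ∃ c : K, D.ρ (perm3to2 σ) (f a) = c • f a ∧
      D.ρ (perm3to2 σ) (g b) = c • g b := by
    rcases hab with ⟨ha, hb⟩ | ⟨ha, hb⟩
    · exact ⟨1, by rw [hf.even ha, one_smul], by rw [hg.even hb, one_smul]⟩
    · exact ⟨_, hf.odd ha _, hg.odd hb _⟩
  refine ⟨c, ?_⟩
  rw [crossTerm, map_add, map_smul, act_tau, act_tau, ha, hb, tau_smul_right, tau_smul_right,
    smul_add, smul_comm c]

theorem crossTerm_mem_crossRel {A B D : GrS2Mod K} (f : A.carrier →ₗ[K] D.carrier)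
    (g : B.carrier →ₗ[K] D.carrier) {i j : ℤ} {a : A.carrier} {b : B.carrier}
    (ha : a ∈ A.deg i) (hb : b ∈ B.deg j) (hab : SameParity a b) (o : Fin 3) :
    crossTerm f g o i j a b ∈ crossRel A B f g := by
  -- Every tree is reached from the tree `2` by a cyclic, hence even, permutation.
  obtain ⟨σ, hσ, hs⟩ : ∃ σ : Equiv.Perm (Fin 3), σ 2 = o ∧ perm3to2 σ = 1 := by
    refine ⟨finRotate 3 ^ (o.1 + 1), ?_, ?_⟩ <;> revert o <;> decide
  refine Submodule.subset_span ⟨σ, i, j, a, b, ha, hb, hab, ?_⟩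
  rw [crossTerm, map_add, map_smul, act_tau, act_tau, hσ, hs, map_one]
  rfl

/-- The bracket relations are spanned by the elements `τₒ(a, b) + (-1)^(|a||b|) τₒ(b, a)`, where `o`
runs over the three trees. -/
theorem crossRel_eq_span {A B D : GrS2Mod K} {f : A.carrier →ₗ[K] D.carrier}
    {g : B.carrier →ₗ[K] D.carrier} (hf : IsHom f) (hg : IsHom g) :
    crossRel A B f g = Submodule.span K {t | ∃ (o : Fin 3) (i j : ℤ) (a : A.carrier)
      (b : B.carrier), a ∈ A.deg i ∧ b ∈ B.deg j ∧ SameParity a b ∧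
      t = crossTerm f g o i j a b} := by
  refine le_antisymm (Submodule.span_le.2 ?_) (Submodule.span_le.2 ?_)
  · rintro _ ⟨σ, i, j, a, b, ha, hb, hab, rfl⟩
    obtain ⟨c, hc⟩ := act_tau_add_tau hf hg hab i j σ
    rw [hc]
    exact Submodule.smul_mem _ c (Submodule.subset_span ⟨_, i, j, a, b, ha, hb, hab, rfl⟩)
  · rintro _ ⟨o, i, j, a, b, ha, hb, hab, rfl⟩
    exact crossTerm_mem_crossRel f g ha hb hab o

theorem crossRel_zero_map_left (A B : GrS2Mod K) {D : GrS2Mod K} (g : B.carrier →ₗ[K] D.carrier) :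
    crossRel A B (0 : A.carrier →ₗ[K] D.carrier) g = ⊥ := by
  refine le_bot_iff.1 (Submodule.span_le.2 ?_)
  rintro _ ⟨σ, i, j, a, b, ha, hb, hab, rfl⟩
  simp [tau]

theorem crossRel_zero_map_right (A B : GrS2Mod K) {D : GrS2Mod K}
    (f : A.carrier →ₗ[K] D.carrier) :
    crossRel A B f (0 : B.carrier →ₗ[K] D.carrier) = ⊥ := by
  refine le_bot_iff.1 (Submodule.span_le.2 ?_)
  rintro _ ⟨σ, i, j, a, b, ha, hb, hab, rfl⟩
  simp [tau]

theorem T3map_zero {A B : GrS2Mod K} (t : A.T3) :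
    T3map (0 : A.carrier →ₗ[K] B.carrier) t = 0 := by
  funext o
  simp [T3map_apply]

/-! ### Parity -/

/-- The trivial character and the signature are the only characters of `S₂`. -/
theorem eq_one_or_eq_sign (ψ : Equiv.Perm (Fin 2) →* ℤˣ) : ψ = 1 ∨ ψ = Equiv.Perm.sign := by
  have hS : ∀ σ : Equiv.Perm (Fin 2), σ = 1 ∨ σ = Equiv.swap 0 1 := by decide
  have hsign : Equiv.Perm.sign (Equiv.swap (0 : Fin 2) 1) = -1 := by decide
  rcases Int.units_eq_one_or (ψ (Equiv.swap 0 1)) with h | h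
  · refine Or.inl (MonoidHom.ext fun σ => ?_)
    rcases hS σ with rfl | rfl
    · simp
    · rw [h, MonoidHom.one_apply]
  · refine Or.inr (MonoidHom.ext fun σ => ?_)
    rcases hS σ with rfl | rfl
    · simp
    · rw [h, hsign]

/-- Two elements have the same parity if `S₂` acts on both of them through one character. -/
theorem sameParity_iff {A B : GrS2Mod K} {a : A.carrier} {b : B.carrier} :
    SameParity a b ↔ ∃ ψ : Equiv.Perm (Fin 2) →* ℤˣ,
      (∀ σ, A.ρ σ a = chi K ψ σ • a) ∧ ∀ σ, B.ρ σ b = chi K ψ σ • b := by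
  have h1 : ∀ σ, chi K 1 σ = 1 := fun σ => by simp [chi]
  constructor
  · rintro (⟨ha, hb⟩ | ⟨ha, hb⟩)
    · exact ⟨1, fun σ => by rw [ha σ, h1, one_smul], fun σ => by rw [hb σ, h1, one_smul]⟩
    · exact ⟨Equiv.Perm.sign, ha, hb⟩
  · rintro ⟨ψ, ha, hb⟩
    rcases eq_one_or_eq_sign ψ with rfl | rfl
    · exact Or.inl ⟨fun σ => by rw [ha, h1, one_smul], fun σ => by rw [hb, h1, one_smul]⟩
    · exact Or.inr ⟨ha, hb⟩

theorem chi_mul (χ ψ : Equiv.Perm (Fin 2) →* ℤˣ) (σ : Equiv.Perm (Fin 2)) :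
    chi K (χ * ψ) σ = chi K χ σ * chi K ψ σ := by
  simp [chi]

theorem SameParity.tmul (χ : Equiv.Perm (Fin 2) →* ℤˣ) {A A' B B' : GrS2Mod K} {a : A.carrier}
    {a' : A'.carrier} {b : B.carrier} {b' : B'.carrier} (ha : SameParity a a')
    (hb : SameParity b b') :
    SameParity (A := GrS2Mod.tensor χ A B) (B := GrS2Mod.tensor χ A' B') (a ⊗ₜ[K] b)
      (a' ⊗ₜ[K] b') := by
  obtain ⟨ψ, ha, ha'⟩ := sameParity_iff.1 ha
  obtain ⟨ψ', hb, hb'⟩ := sameParity_iff.1 hb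
  refine sameParity_iff.2 ⟨χ * (ψ * ψ'), fun σ => ?_, fun σ => ?_⟩
  · rw [tensorRep_tmul χ A B, ha, hb, smul_tmul_smul, smul_smul, chi_mul, chi_mul]
  · rw [tensorRep_tmul χ A' B', ha', hb', smul_tmul_smul, smul_smul, chi_mul, chi_mul]

theorem sameParity_one (χ : Equiv.Perm (Fin 2) →* ℤˣ) :
    SameParity (A := unit K χ) (B := unit K χ) (1 : K) (1 : K) :=
  sameParity_iff.2 ⟨χ, fun _ => rfl, fun _ => rfl⟩

/-! ### The diagonal of the unit -/

/-- The diagonal `χ → χ ⊕ χ` maps `Σₒ τₒ(e, e)` to its copies in the two summands plus the bracket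
relations of the two generators. -/
theorem T3map_diag_unitRel (χ : Equiv.Perm (Fin 2) →* ℤˣ) :
    T3map (A := unit K χ) (B := directSum (unit K χ) (unit K χ))
      (LinearMap.prod LinearMap.id LinearMap.id) (unitRel K χ) =
    T3map (B := directSum (unit K χ) (unit K χ)) (LinearMap.inl K K K) (unitRel K χ) +
      T3map (B := directSum (unit K χ) (unit K χ)) (LinearMap.inr K K K) (unitRel K χ) +
      ∑ o, crossTerm (A := unit K χ) (B := unit K χ) (D := directSum (unit K χ) (unit K χ))
        (LinearMap.inl K K K) (LinearMap.inr K K K) o 0 0 (1 : K) (1 : K) := by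
  have h : LinearMap.prod LinearMap.id LinearMap.id =
      LinearMap.inl K K K + LinearMap.inr K K K := by ext <;> simp
  funext o
  have hc : (∑ p, crossTerm (A := unit K χ) (B := unit K χ)
      (D := directSum (unit K χ) (unit K χ)) (LinearMap.inl K K K) (LinearMap.inr K K K) p 0 0
      (1 : K) (1 : K)) o = LinearMap.inl K K K 1 ⊗ₜ[K] LinearMap.inr K K K 1 +
        LinearMap.inr K K K 1 ⊗ₜ[K] LinearMap.inl K K K 1 := by
    rw [Finset.sum_apply, Finset.sum_eq_single o]
    · simp [crossTerm, tau, ksign_zero]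
    · intro p _ hp
      simp [crossTerm, tau, Pi.single_eq_of_ne hp.symm]
    · simp
  rw [Pi.add_apply, Pi.add_apply, T3map_apply, T3map_apply, T3map_apply, unitRel_apply, hc, h,
    TensorProduct.map_tmul, TensorProduct.map_tmul, TensorProduct.map_tmul, LinearMap.add_apply,
    add_tmul, tmul_add, tmul_add]
  abel

/-! ### The interchange law on products of bracket relations -/

theorem ksign_mul_self (n : ℤ) : ksign K n * ksign K n = 1 := by
  rw [← ksign_add, ksign, Int.negOnePow_even _ ⟨n, rfl⟩]
  simp

theorem isHom_pr14 (χ : Equiv.Perm (Fin 2) →* ℤˣ) (A A' B B' : GrS2Mod K) :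
    IsHom (A := tensor χ (directSum A A') (directSum B B'))
      (B := directSum (tensor χ A B) (tensor χ A' B')) (pr14 A A' B B') :=
  ((isHom_fst A A').tensor χ (isHom_fst B B')).prod ((isHom_snd A A').tensor χ (isHom_snd B B'))

/-- The interchange law maps the product of two bracket relations to a bracket relation. -/
theorem T3map_pr14_psi_crossTerm_mem (χ : Equiv.Perm (Fin 2) →* ℤˣ) {A A' B B' : GrS2Mod K}
    {i i' j j' : ℤ} {a : A.carrier} {a' : A'.carrier} {b : B.carrier} {b' : B'.carrier}
    (ha : a ∈ A.deg i) (ha' : a' ∈ A'.deg i') (hb : b ∈ B.deg j) (hb' : b' ∈ B'.deg j')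
    (haa' : SameParity a a') (hbb' : SameParity b b') (o o' : Fin 3) :
    T3map (A := tensor χ (directSum A A') (directSum B B'))
      (B := directSum (tensor χ A B) (tensor χ A' B')) (pr14 A A' B B')
      (psi χ (directSum A A') (directSum B B')
        (crossTerm (D := directSum A A') (LinearMap.inl K A.carrier A'.carrier)
          (LinearMap.inr K A.carrier A'.carrier) o i i' a a')
        (crossTerm (D := directSum B B') (LinearMap.inl K B.carrier B'.carrier)
          (LinearMap.inr K B.carrier B'.carrier) o' j j' b b')) ∈
      bracket (tensor χ A B) (tensor χ A' B') := by
  by_cases h : o = o'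
  swap
  · simp only [crossTerm, map_add, map_smul, LinearMap.add_apply, LinearMap.smul_apply,
      psi_tau_of_ne χ (directSum A A') (directSum B B') h, smul_zero, add_zero, map_zero]
    exact zero_mem _
  subst h
  have e11 : ∀ x y, pr14 A A' B B' ((x, 0) ⊗ₜ[K] (y, 0)) = (x ⊗ₜ[K] y, 0) := fun x y => by
    simp [pr14]
  have e12 : ∀ x y, pr14 A A' B B' ((x, 0) ⊗ₜ[K] (0, y)) = 0 := fun x y => by
    simp [pr14]
  have e21 : ∀ x y, pr14 A A' B B' ((0, x) ⊗ₜ[K] (y, 0)) = 0 := fun x y => by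
    simp [pr14]
  have e22 : ∀ x y, pr14 A A' B B' ((0, x) ⊗ₜ[K] (0, y)) = (0, x ⊗ₜ[K] y) := fun x y => by
    simp [pr14]
  have dl : ((a, 0) : A.carrier × A'.carrier) ∈ sumDeg A A' i := ⟨ha, zero_mem _⟩
  have dr : ((0, a') : A.carrier × A'.carrier) ∈ sumDeg A A' i' := ⟨zero_mem _, ha'⟩
  have dl' : ((b, 0) : B.carrier × B'.carrier) ∈ sumDeg B B' j := ⟨hb, zero_mem _⟩
  have dr' : ((0, b') : B.carrier × B'.carrier) ∈ sumDeg B B' j' := ⟨zero_mem _, hb'⟩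
  have main : T3map (A := tensor χ (directSum A A') (directSum B B'))
      (B := directSum (tensor χ A B) (tensor χ A' B')) (pr14 A A' B B')
      (psi χ (directSum A A') (directSum B B')
        (crossTerm (D := directSum A A') (LinearMap.inl K A.carrier A'.carrier)
          (LinearMap.inr K A.carrier A'.carrier) o i i' a a')
        (crossTerm (D := directSum B B') (LinearMap.inl K B.carrier B'.carrier)
          (LinearMap.inr K B.carrier B'.carrier) o j j' b b')) =
      ksign K (i' * j) • crossTerm (A := tensor χ A B) (B := tensor χ A' B')
        (D := directSum (tensor χ A B) (tensor χ A' B'))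
        (LinearMap.inl K (A.carrier ⊗[K] B.carrier) (A'.carrier ⊗[K] B'.carrier))
        (LinearMap.inr K (A.carrier ⊗[K] B.carrier) (A'.carrier ⊗[K] B'.carrier))
        o (i + j) (i' + j') (a ⊗ₜ b) (a' ⊗ₜ b') := by
    simp only [crossTerm, LinearMap.inl_apply, LinearMap.inr_apply, map_add, map_smul,
      LinearMap.add_apply, LinearMap.smul_apply]
    rw [psi_tau_self χ (directSum A A') (directSum B B') o _ _ dr dl',
      psi_tau_self χ (directSum A A') (directSum B B') o _ _ dr dr',
      psi_tau_self χ (directSum A A') (directSum B B') o _ _ dl dl',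
      psi_tau_self χ (directSum A A') (directSum B B') o _ _ dl dr']
    simp only [map_smul, T3map_tau]
    rw [e11, e12, e21, e22]
    rw [tau_zero_left, smul_zero, smul_zero, smul_zero, add_zero, zero_add,
      smul_add]
    congr 1
    rw [smul_smul, smul_smul, smul_smul]
    congr 1
    -- Of the four summands of `(i + j) * (i' + j')`, the summand `i' * j` is cancelled by the sign
    -- in front of the bracket relation.
    rw [show (i + j) * (i' + j') = i * i' + j * j' + i * j' + i' * j by ring, ksign_add, ksign_add,
      ksign_add]
    linear_combination (-(ksign K (i * i') * ksign K (j * j') * ksign K (i * j'))) *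
      ksign_mul_self (K := K) (i' * j)
  rw [main]
  exact Submodule.smul_mem _ _ (crossTerm_mem_crossRel
    (D := directSum (tensor χ A B) (tensor χ A' B')) _ _ (tmul_mem A B rfl ha hb)
    (tmul_mem A' B' rfl ha' hb') (haa'.tmul χ hbb') o)

end GrS2Mod

namespace BOQD

open GrS2Mod

variable {K : Type u} [Field K]

/-! ### The interchange law as a morphism -/

theorem T3map_fst_mem (A B : BOQD K) : ∀ t ∈ circRel A B,
    T3map (A := directSum A.gen B.gen) (LinearMap.fst K A.gen.carrier B.gen.carrier) t ∈ A.rel :=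
  map_rel_of_circ (D := A) (isHom_fst A.gen B.gen) (f := LinearMap.id) (g := 0) rfl
    (LinearMap.fst_comp_inr K _ _) (fun t ht => by rw [T3map_id]; exact ht)
    (fun t _ => by rw [T3map_zero]; exact zero_mem _)
    (by rw [crossRel_zero_map_right]; exact bot_le)

theorem T3map_snd_mem (A B : BOQD K) : ∀ t ∈ circRel A B,
    T3map (A := directSum A.gen B.gen) (LinearMap.snd K A.gen.carrier B.gen.carrier) t ∈ B.rel :=
  map_rel_of_circ (D := B) (isHom_snd A.gen B.gen) (f := 0) (g := LinearMap.id)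
    (LinearMap.snd_comp_inl K _ _) rfl (fun t _ => by rw [T3map_zero]; exact zero_mem _)
    (fun t ht => by rw [T3map_id]; exact ht)
    (by rw [crossRel_zero_map_left]; exact bot_le)

/-- A transfer along the commutative square `h ∘ (f ⊗ g) = k ∘ (f' ⊗ g')`, by the naturality of `Ψ`:
membership of `h (Ψ (f r, g s))` in `P` is reduced to that of the `k`-images of the relations of
`A • B`, among which is `Ψ (f' r, g' s)`. -/
theorem T3map_psi_mem (χ : Equiv.Perm (Fin 2) →* ℤˣ) {C D E F H : GrS2Mod K} {A B : BOQD K}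
    {f : C.carrier →ₗ[K] E.carrier} {g : D.carrier →ₗ[K] F.carrier} (hf : IsHom f) (hg : IsHom g)
    {f' : C.carrier →ₗ[K] A.gen.carrier} {g' : D.carrier →ₗ[K] B.gen.carrier} (hf' : IsHom f')
    (hg' : IsHom g') {h : E.carrier ⊗[K] F.carrier →ₗ[K] H.carrier}
    {k : A.gen.carrier ⊗[K] B.gen.carrier →ₗ[K] H.carrier}
    (e : h ∘ₗ TensorProduct.map f g = k ∘ₗ TensorProduct.map f' g') {P : Submodule K H.T3}
    (hk : ∀ t ∈ (black χ A B).rel, T3map (A := tensor χ A.gen B.gen) k t ∈ P) {r : C.T3} {s : D.T3}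
    (hr : T3map f' r ∈ A.rel) (hs : T3map g' s ∈ B.rel) :
    T3map (A := tensor χ E F) h (psi χ E F (T3map f r) (T3map g s)) ∈ P := by
  rw [← psi_map χ hf hg, ← LinearMap.comp_apply, ← T3map_comp (A := tensor χ C D)
    (B := tensor χ E F), e, T3map_comp (A := tensor χ C D) (B := tensor χ A.gen B.gen),
    LinearMap.comp_apply, psi_map χ hf' hg']
  exact hk _ (Submodule.apply_mem_map₂ _ hr hs)

/-- The interchange law maps relations to relations. -/
theorem map₂_psi_circRel_le (χ : Equiv.Perm (Fin 2) →* ℤˣ) (A A' B B' : BOQD K) :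
    (black χ (circ A A') (circ B B')).rel ≤
      (circRel (black χ A B) (black χ A' B')).comap
        (T3map (A := tensor χ (directSum A.gen A'.gen) (directSum B.gen B'.gen))
          (B := directSum (tensor χ A.gen B.gen) (tensor χ A'.gen B'.gen))
          (pr14 A.gen A'.gen B.gen B'.gen)) := by
  set P := (circRel (black χ A B) (black χ A' B')).comap
        (T3map (A := tensor χ (directSum A.gen A'.gen) (directSum B.gen B'.gen))
          (B := directSum (tensor χ A.gen B.gen) (tensor χ A'.gen B'.gen))
          (pr14 A.gen A'.gen B.gen B'.gen))
  have outerL : ∀ t ∈ (black χ A B).rel, T3map (A := tensor χ A.gen B.gen)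
      (B := directSum (tensor χ A.gen B.gen) (tensor χ A'.gen B'.gen))
      (LinearMap.inl K _ _) t ∈ circRel (black χ A B) (black χ A' B') :=
    fun t ht => inl_mem_circRel (A := black χ A B) (black χ A' B') ht
  have outerR : ∀ t ∈ (black χ A' B').rel, T3map (A := tensor χ A'.gen B'.gen)
      (B := directSum (tensor χ A.gen B.gen) (tensor χ A'.gen B'.gen))
      (LinearMap.inr K _ _) t ∈ circRel (black χ A B) (black χ A' B') :=
    fun t ht => inr_mem_circRel (black χ A B) (B := black χ A' B') ht
  have idm : ∀ (X : GrS2Mod K) (s : X.T3), T3map (A := X) (B := X) LinearMap.id s = s :=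
    fun X s => by rw [T3map_id]; rfl
  -- Products with a relation of a summand, treated through the projection of the other factor.
  have left : ∀ r ∈ A.rel, ∀ s ∈ circRel B B', psi χ (directSum A.gen A'.gen)
      (directSum B.gen B'.gen) (T3map (B := directSum A.gen A'.gen) (LinearMap.inl K _ _) r) s ∈ P :=
    fun r hr s hs => by
      rw [← idm _ s]
      exact T3map_psi_mem χ (A := A) (B := B) (isHom_inl A.gen A'.gen) (IsHom.id _) (IsHom.id A.gen)
        (isHom_fst B.gen B'.gen) (H := directSum (tensor χ A.gen B.gen) (tensor χ A'.gen B'.gen))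
        (TensorProduct.ext' fun x y => by simp [pr14])
        outerL (by rw [idm]; exact hr) (T3map_fst_mem B B' s hs)
  have right : ∀ r ∈ A'.rel, ∀ s ∈ circRel B B', psi χ (directSum A.gen A'.gen)
      (directSum B.gen B'.gen) (T3map (B := directSum A.gen A'.gen) (LinearMap.inr K _ _) r) s ∈ P :=
    fun r hr s hs => by
      rw [← idm _ s]
      exact T3map_psi_mem χ (A := A') (B := B') (isHom_inr A.gen A'.gen) (IsHom.id _)
        (IsHom.id A'.gen)
        (isHom_snd B.gen B'.gen) (H := directSum (tensor χ A.gen B.gen) (tensor χ A'.gen B'.gen))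
        (TensorProduct.ext' fun x y => by simp [pr14])
        outerR (by rw [idm]; exact hr) (T3map_snd_mem B B' s hs)
  have left' : ∀ r ∈ circRel A A', ∀ s ∈ B.rel, psi χ (directSum A.gen A'.gen)
      (directSum B.gen B'.gen) r (T3map (B := directSum B.gen B'.gen) (LinearMap.inl K _ _) s) ∈ P :=
    fun r hr s hs => by
      rw [← idm _ r]
      exact T3map_psi_mem χ (A := A) (B := B) (IsHom.id _) (isHom_inl B.gen B'.gen)
        (isHom_fst A.gen A'.gen) (IsHom.id B.gen)
        (H := directSum (tensor χ A.gen B.gen) (tensor χ A'.gen B'.gen))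
        (TensorProduct.ext' fun x y => by simp [pr14])
        outerL (T3map_fst_mem A A' r hr) (by rw [idm]; exact hs)
  have right' : ∀ r ∈ circRel A A', ∀ s ∈ B'.rel, psi χ (directSum A.gen A'.gen)
      (directSum B.gen B'.gen) r (T3map (B := directSum B.gen B'.gen) (LinearMap.inr K _ _) s) ∈ P :=
    fun r hr s hs => by
      rw [← idm _ r]
      exact T3map_psi_mem χ (A := A') (B := B') (IsHom.id _) (isHom_inr B.gen B'.gen)
        (isHom_snd A.gen A'.gen) (IsHom.id B'.gen)
        (H := directSum (tensor χ A.gen B.gen) (tensor χ A'.gen B'.gen))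
        (TensorProduct.ext' fun x y => by simp [pr14])
        outerR (T3map_snd_mem A A' r hr) (by rw [idm]; exact hs)
  -- Products of two bracket relations.
  have mid : Submodule.map₂ (psi χ (directSum A.gen A'.gen) (directSum B.gen B'.gen))
      (bracket A.gen A'.gen) (bracket B.gen B'.gen) ≤ P := by
    rw [bracket, bracket, crossRel_eq_span (isHom_inl A.gen A'.gen) (isHom_inr A.gen A'.gen),
      crossRel_eq_span (isHom_inl B.gen B'.gen) (isHom_inr B.gen B'.gen), Submodule.map₂_span_span]
    refine Submodule.span_le.2 ?_
    rintro _ ⟨_, ⟨o, i, i', a, a', ha, ha', haa, rfl⟩, _, ⟨o', j, j', b, b', hb, hb', hbb, rfl⟩, rfl⟩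
    exact bracket_le_circRel (black χ A B) (black χ A' B')
      (T3map_pr14_psi_crossTerm_mem χ ha ha' hb hb' haa hbb o o')
  refine Submodule.map₂_le.2 fun r hr s hs => ?_
  refine circRel_le (P := P.comap ((psi χ (directSum A.gen A'.gen) (directSum B.gen B'.gen)).flip s))
    (fun t ht => left t ht s hs) (fun t ht => right t ht s hs) (fun t ht => ?_) hr
  refine circRel_le (P := P.comap (psi χ (directSum A.gen A'.gen) (directSum B.gen B'.gen) t))
    (fun s hs => left' t (bracket_le_circRel A A' ht) s hs)
    (fun s hs => right' t (bracket_le_circRel A A' ht) s hs)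
    (fun s hs => mid (Submodule.apply_mem_map₂ _ ht hs)) hs

/-- The interchange law `(A ⊚ A') • (B ⊚ B') ⟶ (A • B) ⊚ (A' • B')`. -/
noncomputable def interchange (χ : Equiv.Perm (Fin 2) →* ℤˣ) (A A' B B' : BOQD K) :
    black χ (circ A A') (circ B B') ⟶ circ (black χ A B) (black χ A' B') where
  lin := pr14 A.gen A'.gen B.gen B'.gen
  isHom := isHom_pr14 χ A.gen A'.gen B.gen B'.gen
  map_rel _ ht := map₂_psi_circRel_le χ A A' B B' ht

/-! ### The lax and the colax structure -/

theorem T3map_diag_mem (χ : Equiv.Perm (Fin 2) →* ℤˣ) {t : (unit K χ).T3}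
    (ht : t ∈ (blackUnit K χ).rel) :
    T3map (A := unit K χ) (B := directSum (unit K χ) (unit K χ))
      (LinearMap.prod LinearMap.id LinearMap.id) t ∈ circRel (blackUnit K χ) (blackUnit K χ) := by
  have h : T3map (A := unit K χ) (B := directSum (unit K χ) (unit K χ))
      (LinearMap.prod LinearMap.id LinearMap.id) (unitRel K χ) ∈
        circRel (blackUnit K χ) (blackUnit K χ) := by
    rw [T3map_diag_unitRel]
    have hu := Submodule.mem_span_singleton_self (R := K) (unitRel K χ)
    exact add_mem (add_mem (inl_mem_circRel (A := blackUnit K χ) (blackUnit K χ) hu)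
      (inr_mem_circRel (blackUnit K χ) (B := blackUnit K χ) hu)) (sum_mem fun o _ =>
        bracket_le_circRel (blackUnit K χ) (blackUnit K χ) (crossTerm_mem_crossRel
          (A := unit K χ) (B := unit K χ) (D := directSum (unit K χ) (unit K χ)) _ _
          one_mem_unitDeg one_mem_unitDeg (sameParity_one χ) o))
  obtain ⟨c, rfl⟩ := Submodule.mem_span_singleton.1 ht
  rw [map_smul]
  exact Submodule.smul_mem _ c h

/-- The unit morphism `χ → χ ⊕ χ` of the lax structure, the diagonal. -/
noncomputable def blackUnitDiag (K : Type u) [Field K] (χ : Equiv.Perm (Fin 2) →* ℤˣ) :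
    blackUnit K χ ⟶ circ (blackUnit K χ) (blackUnit K χ) where
  lin := LinearMap.prod LinearMap.id LinearMap.id
  isHom := (IsHom.id (unit K χ)).prod (IsHom.id (unit K χ))
  map_rel _ ht := T3map_diag_mem χ ht

/-- The counit morphism `0 ⊗ 0 → 0` of the colax structure. -/
noncomputable def circUnitCounit (K : Type u) [Field K] (χ : Equiv.Perm (Fin 2) →* ℤˣ) :
    black χ (circUnit K) (circUnit K) ⟶ circUnit K where
  lin := 0
  isHom := ⟨fun _ _ _ => zero_mem _, fun _ _ => rfl⟩
  map_rel t _ := by rw [T3map_zero]; exact zero_mem _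

theorem isLaxTwoMonoidal_interchange (K : Type u) [Field K] (χ : Equiv.Perm (Fin 2) →* ℤˣ) :
    IsLaxTwoMonoidal (blackMonoidal K χ) (circMonoidal K) (interchange χ) := by
  let _ := blackMonoidal K χ
  refine ⟨{ ε := blackUnitDiag K χ
            μ := fun X Y => interchange χ X.1 X.2 Y.1 Y.2
            μ_natural_left := fun f X => hom_ext (TensorProduct.ext' fun _ _ => rfl)
            μ_natural_right := fun X f => hom_ext (TensorProduct.ext' fun _ _ => rfl)
            associativity := fun X Y Z => hom_ext (TensorProduct.ext_threefold fun _ _ _ => rfl)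
            left_unitality := fun X => hom_ext (TensorProduct.ext' fun _ _ => rfl)
            right_unitality := fun X => hom_ext (TensorProduct.ext' fun _ _ => rfl) },
    fun _ _ _ _ => rfl⟩

theorem isColaxTwoMonoidal_interchange (K : Type u) [Field K] (χ : Equiv.Perm (Fin 2) →* ℤˣ) :
    IsColaxTwoMonoidal (circMonoidal K) (blackMonoidal K χ)
      (fun A A' B B' => interchange χ A B A' B') := by
  let _ := circMonoidal K
  refine ⟨{ η := circUnitCounit K χ
            δ := fun X Y => interchange χ X.1 Y.1 X.2 Y.2
            δ_natural_left := fun f X => hom_ext (TensorProduct.ext' fun _ _ => rfl)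
            δ_natural_right := fun X f => hom_ext (TensorProduct.ext' fun _ _ => rfl)
            oplax_associativity := fun X Y Z => hom_ext (TensorProduct.ext' fun _ _ => rfl)
            oplax_left_unitality := fun X => hom_ext (TensorProduct.ext' fun _ _ => rfl)
            oplax_right_unitality := fun X => hom_ext (TensorProduct.ext' fun _ _ => rfl) },
    fun _ _ _ _ => rfl⟩

end BOQD

theorem mainTheorem2 (K : Type u) [Field K] (hK : (2 : K) ≠ 0)
    (χ : Equiv.Perm (Fin 2) →* ℤˣ) :
    ∃ φ : ∀ A A' B B' : BOQD K,
        BOQD.black χ (BOQD.circ A A') (BOQD.circ B B') ⟶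
          BOQD.circ (BOQD.black χ A B) (BOQD.black χ A' B'),
      (∀ A A' B B' : BOQD K, (φ A A' B B').lin = GrS2Mod.pr14 A.gen A'.gen B.gen B'.gen) ∧
      IsLaxTwoMonoidal (BOQD.blackMonoidal K χ) (BOQD.circMonoidal K) φ ∧
      IsColaxTwoMonoidal (BOQD.circMonoidal K) (BOQD.blackMonoidal K χ)
        (fun A A' B B' => φ A B A' B') :=
  ⟨BOQD.interchange χ, fun _ _ _ _ => rfl, BOQD.isLaxTwoMonoidal_interchange K χ,
    BOQD.isColaxTwoMonoidal_interchange K χ⟩
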